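/- Let $\gamma,\mu>0$. A ball is modelled by two point masses at heights $x(t)$ (lower) and $y(t)$ (upper), with $x(t)\ge 0$ at all times. While $x>0$ they obey $$\ddot x+\mu\dot x+\tfrac12x=-\gamma-\tfrac12+\tfrac12y+\mu\dot y,\qquad \ddot y+\mu\dot y+\tfrac12y=-\gamma+\tfrac12+\tfrac12x+\mu\dot x .$$ At each contact instant $t>0$, $x(t)=0$, the lower mass is reflected elastically, $\dot x(t^+)=-\dot x(t^-)$, while $x$, $y$ and $\dot y$ are continuous. After a contact with zero velocity the lower mass may remain on the floor: then $x=\dot x=0$ and $\ddot y+\mu\dot y+\tfrac12y=-\gamma+\tfrac12$, for as long as the force $F=\tfrac12y+\mu\dot y-\gamma-\tfrac12$ on the lower mass is $\le 0$. A solution on $[0,T)$, $0<T\le\infty$, is such a motion that consists of successive flights ($x>0$) and continuous contacts ($x\equiv0$), finitely many in each $[0,S]$ with $S<T$; thus contacts may a priori accumulate at $T$ if $T<\infty$ (inelastic collapse). A grazing is a time $t_s$ with $x(t_s)=\dot x(t_s)=0$ and $\ddot x(t_s)>0$. Theorem. Every initial condition $(x,\dot x,y,\dot y)(0)=(x_0,u_0,y_0,v_0)\in\mathbb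 R^4$ with $x_0\ge0$, and with $u_0\ge0$ if $x_0=0$ (velocity after the impact), generates a solution defined for all times $t\ge 0$; and every solution starting from it, on any interval $[0,T)$ with $0<T\le\infty$, contains at most a finite number of grazings. -/

import Mathlib

open Set Filter Topology

namespace BouncingBall

/-- A motion of the ball: height `x` and velocity `u` of the lower point mass, height `y` and
velocity `v` of the upper point mass, as functions of (dimensionless) time. Only the values at
times in the interval of existence matter. -/
structure Motion where
  x : ℝ → ℝ
  u : ℝ → ℝ
  y : ℝ → ℝ
  v : ℝ → ℝ

/-- The time interval `[0, T)`, where `0 ≤ T ≤ ∞`. -/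
def timeDomain (T : EReal) : Set ℝ := {t | 0 ≤ t ∧ (t : EReal) < T}

/-- At time `t` the motion obeys the equations of free flight
`x'' + μ x' + x / 2 = -γ - 1 / 2 + y / 2 + μ y'`,
`y'' + μ y' + y / 2 = -γ + 1 / 2 + x / 2 + μ x'`. -/
structure Motion.FreeAt (γ μ : ℝ) (m : Motion) (t : ℝ) : Prop where
  deriv_x : HasDerivAt m.x (m.u t) t
  deriv_u : HasDerivAt m.u
    (-γ - 1 / 2 + m.y t / 2 + μ * m.v t - μ * m.u t - m.x t / 2) t
  deriv_y : HasDerivAt m.y (m.v t) t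
  deriv_v : HasDerivAt m.v
    (-γ + 1 / 2 + m.x t / 2 + μ * m.u t - μ * m.v t - m.y t / 2) t

/-- The force exerted by the spring and by gravity on the lower point mass when the latter is
at rest on the floor. -/
noncomputable def Motion.floorForce (γ μ : ℝ) (m : Motion) (t : ℝ) : ℝ :=
  m.y t / 2 + μ * m.v t - γ - 1 / 2

/-- At time `t` the lower point mass rests on the floor, is not pulled away from it, and the
upper one obeys `y'' + μ y' + y / 2 = -γ + 1 / 2`. -/
structure Motion.StuckAt (γ μ : ℝ) (m : Motion) (t : ℝ) : Prop where
  x_eq : m.x t = 0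
  u_eq : m.u t = 0
  deriv_y : HasDerivAt m.y (m.v t) t
  deriv_v : HasDerivAt m.v (-γ + 1 / 2 - μ * m.v t - m.y t / 2) t
  force_nonpos : m.floorForce γ μ t ≤ 0

/-- `m` is a solution on `[0, T)` of the equations of motion of the bouncing ball. The value of
`u` at an impact is the velocity after the impact. The conditions `after_contact` and
`before_contact` say that every contact instant has on each side a short interval which is
either entirely flight or entirely a continuous contact; equivalently, the motion consists of
successive flights and continuous contacts, finitely many of them in each `[0, S]` with
`S < T`, so that impacts could accumulate only at the end `T` (inelastic collapse). -/
structure Motion.IsSolution (γ μ : ℝ) (T : EReal) (m : Motion) : Prop where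
  x_nonneg : ∀ t ∈ timeDomain T, 0 ≤ m.x t
  x_cont : ContinuousOn m.x (timeDomain T)
  y_cont : ContinuousOn m.y (timeDomain T)
  v_cont : ContinuousOn m.v (timeDomain T)
  u_right_cont : ∀ t ∈ timeDomain T, ContinuousWithinAt m.u (Ici t) t
  /-- elastic reflection of the lower point mass at the floor -/
  impact : ∀ t ∈ timeDomain T, 0 < t → m.x t = 0 → Tendsto m.u (𝓝[<] t) (𝓝 (-m.u t))
  flight : ∀ t ∈ timeDomain T, 0 < t → 0 < m.x t → m.FreeAt γ μ t
  after_contact : ∀ t ∈ timeDomain T, m.x t = 0 →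
    (∀ᶠ s in 𝓝[>] t, 0 < m.x s) ∨ (∀ᶠ s in 𝓝[>] t, m.StuckAt γ μ s)
  before_contact : ∀ t ∈ timeDomain T, 0 < t → m.x t = 0 →
    (∀ᶠ s in 𝓝[<] t, 0 < m.x s) ∨ (∀ᶠ s in 𝓝[<] t, m.StuckAt γ μ s)

/-- `m` starts at time `0` from the given state. -/
def Motion.StartsFrom (m : Motion) (x₀ u₀ y₀ v₀ : ℝ) : Prop :=
  m.x 0 = x₀ ∧ m.u 0 = u₀ ∧ m.y 0 = y₀ ∧ m.v 0 = v₀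

/-- The grazing times of a motion on `[0, T)`: those `t` with `x = 0`, `x' = 0`, `x'' > 0`. -/
def Motion.grazings (T : EReal) (m : Motion) : Set ℝ :=
  {t | t ∈ timeDomain T ∧ m.x t = 0 ∧ m.u t = 0 ∧
    ∃ a : ℝ, HasDerivWithinAt m.u a (timeDomain T) t ∧ 0 < a}

end BouncingBall

namespace BouncingBall

/-! ### One-sided derivatives from derivatives nearby -/

/-! The energy has right derivative `-μ (v - u)²`, and since `x ≥ 0` it is bounded below and
controls the whole state, so every solution is bounded (`exists_bound`). Impacts flip `u` but keep
`u²` continuous, so the estimates compare continuous functions through right derivatives only.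

On `[0, ∞)`, consider an instant with `x = u = 0` and force `F ≥ 0`. Nearby the upper mass has
acceleration at most `-(K + γ)`, while `|u|` changes at rate at most `K`, where `K = F + γ / 2`.
Hence `|v - u|` is at least `γ` times the elapsed time on one side of the instant, and a fixed
amount of energy is lost (`exists_energy_drop`). Grazings therefore cannot occur at arbitrarily late
times. They are isolated, so there are finitely many.

On a bounded `[0, T)` the core is the absence of inelastic collapse, `flight_or_stuck_near_end`.
Suppose contacts occur arbitrarily close to `T`. Then `x → 0`, and `y`, `v` converge, so the
modified force `f` and its rate have limits at `T`. If `f > 0` near `T`, the mass can neither return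
to the floor nor rest there. If `f < 0` with `-f` growing at most exponentially, then either the
mass already rests, or an adiabatic invariant gives `u² ≥ 2 c (-f)` at contacts. The latter
contradicts the bound `u = O(-f · (T - a))` at a take-off at time `a`, which the mass must satisfy
to fall back before `T` (`return_estimate`). Signs of the limits of `f`, then of `f'`, decide
between the two cases; if both vanish, the second-order limit is exactly `-γ`, which again gives `f
< 0 < f'`.

For existence, the force on a mass at rest, its first derivative and, if both vanish, its second
derivative `-γ` decide between take-off and rest (`exists_startsAt`). Without collapse the state has
a limit at any finite `T`, so a solution can be continued (`exists_extension`), and a maximal one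
given by Zorn's lemma is global. -/

theorem hasDerivWithinAt_Ici_of_eventually {f f' : ℝ → ℝ} {t e : ℝ}
    (hf : ContinuousWithinAt f (Ici t) t) (hd : ∀ᶠ s in 𝓝[>] t, HasDerivAt f (f' s) s)
    (hl : Tendsto f' (𝓝[>] t) (𝓝 e)) : HasDerivWithinAt f e (Ici t) t := by
  have hs : {s | HasDerivAt f (f' s) s} ∩ Ioi t ∈ 𝓝[>] t :=
    inter_mem hd self_mem_nhdsWithin
  refine hasDerivWithinAt_Ici_of_tendsto_deriv (s := {s | HasDerivAt f (f' s) s} ∩ Ioi t)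
    (fun s hs => hs.1.differentiableAt.differentiableWithinAt)
    (hf.mono fun s hs => Ioi_subset_Ici_self hs.2) hs (hl.congr' ?_)
  filter_upwards [hd] with s hs using hs.deriv.symm

theorem hasDerivWithinAt_Iic_of_eventually {f f' : ℝ → ℝ} {t e : ℝ}
    (hf : ContinuousWithinAt f (Iic t) t) (hd : ∀ᶠ s in 𝓝[<] t, HasDerivAt f (f' s) s)
    (hl : Tendsto f' (𝓝[<] t) (𝓝 e)) : HasDerivWithinAt f e (Iic t) t := by
  have hs : {s | HasDerivAt f (f' s) s} ∩ Iio t ∈ 𝓝[<] t :=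
    inter_mem hd self_mem_nhdsWithin
  refine hasDerivWithinAt_Iic_of_tendsto_deriv (s := {s | HasDerivAt f (f' s) s} ∩ Iio t)
    (fun s hs => hs.1.differentiableAt.differentiableWithinAt)
    (hf.mono fun s hs => Iio_subset_Iic_self hs.2) hs (hl.congr' ?_)
  filter_upwards [hd] with s hs using hs.deriv.symm

theorem hasDerivAt_of_left_right {f : ℝ → ℝ} {t e : ℝ} (hl : HasDerivWithinAt f e (Iic t) t)
    (hr : HasDerivWithinAt f e (Ici t) t) : HasDerivAt f e t := by
  have := hl.union hr
  rwa [Iic_union_Ici, hasDerivWithinAt_univ] at this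

/-! ### The time domain -/

theorem timeDomain_of_le {T : EReal} {s t : ℝ} (ht : t ∈ timeDomain T) (hs : 0 ≤ s)
    (hst : s ≤ t) : s ∈ timeDomain T :=
  ⟨hs, lt_of_le_of_lt (by exact_mod_cast hst) ht.2⟩

theorem Icc_subset_timeDomain {T : EReal} {a b : ℝ} (ha : 0 ≤ a) (hb : b ∈ timeDomain T) :
    Icc a b ⊆ timeDomain T := fun _ hs => timeDomain_of_le hb (ha.trans hs.1) hs.2

theorem eventually_coe_lt {T : EReal} {t : ℝ} (ht : t ∈ timeDomain T) :
    ∀ᶠ s : ℝ in 𝓝 t, (s : EReal) < T :=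
  (continuous_coe_real_ereal.tendsto t).eventually (gt_mem_nhds ht.2)

theorem timeDomain_mem_nhdsGE {T : EReal} {t : ℝ} (ht : t ∈ timeDomain T) :
    timeDomain T ∈ 𝓝[≥] t := by
  filter_upwards [nhdsWithin_le_nhds (eventually_coe_lt ht), self_mem_nhdsWithin] with s h1 h2
  exact ⟨ht.1.trans h2, h1⟩

theorem timeDomain_mem_nhds {T : EReal} {t : ℝ} (ht : t ∈ timeDomain T) (h0 : 0 < t) :
    timeDomain T ∈ 𝓝 t := by
  filter_upwards [eventually_coe_lt ht, lt_mem_nhds h0] with s h1 h2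
  exact ⟨le_of_lt h2, h1⟩

/-! ### Accelerations and one-sided derivatives along a solution -/

/-- The acceleration of the lower mass in free flight. -/
noncomputable def Motion.lowerAcc (γ μ : ℝ) (m : Motion) (t : ℝ) : ℝ :=
  -γ - 1 / 2 + m.y t / 2 + μ * m.v t - μ * m.u t - m.x t / 2

/-- The acceleration of the upper mass. -/
noncomputable def Motion.upperAcc (γ μ : ℝ) (m : Motion) (t : ℝ) : ℝ :=
  -γ + 1 / 2 + m.x t / 2 + μ * m.u t - μ * m.v t - m.y t / 2

namespace Motion.IsSolution

variable {γ μ : ℝ} {T : EReal} {m : Motion}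

theorem x_right (h : m.IsSolution γ μ T) {t : ℝ} (ht : t ∈ timeDomain T) :
    ContinuousWithinAt m.x (Ici t) t :=
  (h.x_cont t ht).mono_of_mem_nhdsWithin (timeDomain_mem_nhdsGE ht)

theorem y_right (h : m.IsSolution γ μ T) {t : ℝ} (ht : t ∈ timeDomain T) :
    ContinuousWithinAt m.y (Ici t) t :=
  (h.y_cont t ht).mono_of_mem_nhdsWithin (timeDomain_mem_nhdsGE ht)

theorem v_right (h : m.IsSolution γ μ T) {t : ℝ} (ht : t ∈ timeDomain T) :
    ContinuousWithinAt m.v (Ici t) t :=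
  (h.v_cont t ht).mono_of_mem_nhdsWithin (timeDomain_mem_nhdsGE ht)

theorem x_continuousAt (h : m.IsSolution γ μ T) {t : ℝ} (ht : t ∈ timeDomain T) (h0 : 0 < t) :
    ContinuousAt m.x t := h.x_cont.continuousAt (timeDomain_mem_nhds ht h0)

theorem y_continuousAt (h : m.IsSolution γ μ T) {t : ℝ} (ht : t ∈ timeDomain T) (h0 : 0 < t) :
    ContinuousAt m.y t := h.y_cont.continuousAt (timeDomain_mem_nhds ht h0)

theorem v_continuousAt (h : m.IsSolution γ μ T) {t : ℝ} (ht : t ∈ timeDomain T) (h0 : 0 < t) :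
    ContinuousAt m.v t := h.v_cont.continuousAt (timeDomain_mem_nhds ht h0)

theorem lowerAcc_right (h : m.IsSolution γ μ T) {t : ℝ} (ht : t ∈ timeDomain T) :
    ContinuousWithinAt (m.lowerAcc γ μ) (Ici t) t := by
  have hx := h.x_right ht
  have hy := h.y_right ht
  have hv := h.v_right ht
  have hu := h.u_right_cont t ht
  unfold Motion.lowerAcc
  fun_prop

theorem upperAcc_right (h : m.IsSolution γ μ T) {t : ℝ} (ht : t ∈ timeDomain T) :
    ContinuousWithinAt (m.upperAcc γ μ) (Ici t) t := by
  have hx := h.x_right ht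
  have hy := h.y_right ht
  have hv := h.v_right ht
  have hu := h.u_right_cont t ht
  unfold Motion.upperAcc
  fun_prop

theorem floorForce_right (h : m.IsSolution γ μ T) {t : ℝ} (ht : t ∈ timeDomain T) :
    ContinuousWithinAt (m.floorForce γ μ) (Ici t) t := by
  have hy := h.y_right ht
  have hv := h.v_right ht
  unfold Motion.floorForce
  fun_prop

theorem eventually_freeAt_of_right (h : m.IsSolution γ μ T) {t : ℝ} (ht : t ∈ timeDomain T)
    (hf : ∀ᶠ s in 𝓝[>] t, 0 < m.x s) : ∀ᶠ s in 𝓝[>] t, m.FreeAt γ μ s := by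
  filter_upwards [hf, nhdsWithin_mono t Ioi_subset_Ici_self (timeDomain_mem_nhdsGE ht),
    self_mem_nhdsWithin] with s h1 h2 h3
  exact h.flight s h2 (lt_of_le_of_lt ht.1 h3) h1

theorem eventually_pos_of_pos (h : m.IsSolution γ μ T) {t : ℝ} (ht : t ∈ timeDomain T)
    (hx : 0 < m.x t) : ∀ᶠ s in 𝓝[>] t, 0 < m.x s :=
  nhdsWithin_mono t Ioi_subset_Ici_self ((h.x_right ht).eventually (lt_mem_nhds hx))

theorem right_dichotomy (h : m.IsSolution γ μ T) {t : ℝ} (ht : t ∈ timeDomain T) :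
    (∀ᶠ s in 𝓝[>] t, 0 < m.x s) ∨
      (m.x t = 0 ∧ m.u t = 0 ∧ ∀ᶠ s in 𝓝[>] t, m.StuckAt γ μ s) := by
  rcases (h.x_nonneg t ht).eq_or_lt with h0 | h0
  · rcases h.after_contact t ht h0.symm with h1 | h1
    · exact Or.inl h1
    · refine Or.inr ⟨h0.symm, ?_, h1⟩
      have h2 : Tendsto m.u (𝓝[>] t) (𝓝 (m.u t)) :=
        (h.u_right_cont t ht).mono_left (nhdsWithin_mono t Ioi_subset_Ici_self)
      have h3 : Tendsto m.u (𝓝[>] t) (𝓝 0) :=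
        tendsto_const_nhds.congr' (by filter_upwards [h1] with s hs using hs.u_eq.symm)
      exact tendsto_nhds_unique h2 h3
  · exact Or.inl (h.eventually_pos_of_pos ht h0)

theorem _root_.BouncingBall.tendsto_Ioi {f : ℝ → ℝ} {t : ℝ} (hf : ContinuousWithinAt f (Ici t) t) :
    Tendsto f (𝓝[>] t) (𝓝 (f t)) := hf.mono_left (nhdsWithin_mono t Ioi_subset_Ici_self)

theorem x_deriv (h : m.IsSolution γ μ T) {t : ℝ} (ht : t ∈ timeDomain T) :
    HasDerivWithinAt m.x (m.u t) (Ici t) t := by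
  refine hasDerivWithinAt_Ici_of_eventually (f' := m.u) (h.x_right ht) ?_
    (tendsto_Ioi (h.u_right_cont t ht))
  rcases h.right_dichotomy ht with h1 | ⟨-, -, h1⟩
  · filter_upwards [h.eventually_freeAt_of_right ht h1] with s hs using hs.deriv_x
  · obtain ⟨b, hb, hsub⟩ := mem_nhdsGT_iff_exists_Ioo_subset.1 h1
    filter_upwards [Ioo_mem_nhdsGT hb] with s hs
    rw [(hsub hs).u_eq]
    refine (hasDerivAt_const s (0 : ℝ)).congr_of_eventuallyEq ?_
    filter_upwards [isOpen_Ioo.mem_nhds hs] with r hr using (hsub hr).x_eq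

theorem y_deriv (h : m.IsSolution γ μ T) {t : ℝ} (ht : t ∈ timeDomain T) :
    HasDerivWithinAt m.y (m.v t) (Ici t) t := by
  refine hasDerivWithinAt_Ici_of_eventually (f' := m.v) (h.y_right ht) ?_
    (tendsto_Ioi (h.v_right ht))
  rcases h.right_dichotomy ht with h1 | ⟨-, -, h1⟩
  · filter_upwards [h.eventually_freeAt_of_right ht h1] with s hs using hs.deriv_y
  · filter_upwards [h1] with s hs using hs.deriv_y

theorem v_deriv (h : m.IsSolution γ μ T) {t : ℝ} (ht : t ∈ timeDomain T) :
    HasDerivWithinAt m.v (m.upperAcc γ μ t) (Ici t) t := by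
  refine hasDerivWithinAt_Ici_of_eventually (f' := m.upperAcc γ μ) (h.v_right ht) ?_
    (tendsto_Ioi (h.upperAcc_right ht))
  rcases h.right_dichotomy ht with h1 | ⟨-, -, h1⟩
  · filter_upwards [h.eventually_freeAt_of_right ht h1] with s hs using hs.deriv_v
  · filter_upwards [h1] with s hs
    have := hs.deriv_v
    unfold Motion.upperAcc
    rw [hs.x_eq, hs.u_eq]
    simpa using this

theorem u_deriv_of_flight (h : m.IsSolution γ μ T) {t : ℝ} (ht : t ∈ timeDomain T)
    (hf : ∀ᶠ s in 𝓝[>] t, 0 < m.x s) :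
    HasDerivWithinAt m.u (m.lowerAcc γ μ t) (Ici t) t := by
  refine hasDerivWithinAt_Ici_of_eventually (f' := m.lowerAcc γ μ) (h.u_right_cont t ht) ?_
    (tendsto_Ioi (h.lowerAcc_right ht))
  filter_upwards [h.eventually_freeAt_of_right ht hf] with s hs using hs.deriv_u

theorem u_deriv_of_stuck (h : m.IsSolution γ μ T) {t : ℝ} (ht : t ∈ timeDomain T)
    (hf : ∀ᶠ s in 𝓝[>] t, m.StuckAt γ μ s) : HasDerivWithinAt m.u 0 (Ici t) t := by
  refine hasDerivWithinAt_Ici_of_eventually (f' := fun _ => 0) (h.u_right_cont t ht) ?_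
    tendsto_const_nhds
  obtain ⟨b, hb, hsub⟩ := mem_nhdsGT_iff_exists_Ioo_subset.1 hf
  filter_upwards [Ioo_mem_nhdsGT hb] with s hs
  refine (hasDerivAt_const s (0 : ℝ)).congr_of_eventuallyEq ?_
  filter_upwards [isOpen_Ioo.mem_nhds hs] with r hr using (hsub hr).u_eq

theorem floorForce_nonpos_of_stuck (h : m.IsSolution γ μ T) {t : ℝ} (ht : t ∈ timeDomain T)
    (hf : ∀ᶠ s in 𝓝[>] t, m.StuckAt γ μ s) : m.floorForce γ μ t ≤ 0 :=
  le_of_tendsto (tendsto_Ioi (h.floorForce_right ht))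
    (by filter_upwards [hf] with s hs using hs.force_nonpos)

/-- The right derivative of the velocity of the lower mass: either that of free flight, or `0`
at the beginning of and during a continuous contact. -/
theorem u_deriv (h : m.IsSolution γ μ T) {t : ℝ} (ht : t ∈ timeDomain T) :
    ∃ a, HasDerivWithinAt m.u a (Ici t) t ∧
      (a = m.lowerAcc γ μ t ∨ (a = 0 ∧ m.x t = 0 ∧ m.u t = 0)) := by
  rcases h.right_dichotomy ht with h1 | ⟨hx, hu, h1⟩
  · exact ⟨_, h.u_deriv_of_flight ht h1, Or.inl rfl⟩
  · exact ⟨0, h.u_deriv_of_stuck ht h1, Or.inr ⟨rfl, hx, hu⟩⟩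

theorem u_nonneg_of_contact (h : m.IsSolution γ μ T) {t : ℝ} (ht : t ∈ timeDomain T)
    (hx : m.x t = 0) : 0 ≤ m.u t := by
  have h1 := (h.x_deriv ht).mono Ioi_subset_Ici_self
  have h2 : Tendsto (slope m.x t) (𝓝[>] t) (𝓝 (m.u t)) :=
    (hasDerivWithinAt_iff_tendsto_slope' self_notMem_Ioi).1 h1
  refine ge_of_tendsto h2 ?_
  filter_upwards [nhdsWithin_mono t Ioi_subset_Ici_self (timeDomain_mem_nhdsGE ht),
    self_mem_nhdsWithin] with s hs hst
  rw [slope_def_field, hx, sub_zero]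
  exact div_nonneg (h.x_nonneg s hs) (sub_nonneg.2 (le_of_lt hst))

/-- Squaring removes the sign change at impacts, the only discontinuity of `u`. This makes the
energy continuous. -/
theorem sq_u_continuousOn (h : m.IsSolution γ μ T) :
    ContinuousOn (fun t => m.u t ^ 2) (timeDomain T) := by
  intro t ht
  have hr : ContinuousWithinAt (fun t => m.u t ^ 2) (Ici t) t := (h.u_right_cont t ht).pow 2
  rcases ht.1.eq_or_lt with h0 | h0
  · subst h0
    exact hr.mono fun s hs => hs.1
  · refine ContinuousAt.continuousWithinAt ?_
    rcases (h.x_nonneg t ht).eq_or_lt with hx | hx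
    · refine continuousAt_iff_continuous_left'_right'.2
        ⟨?_, hr.mono Ioi_subset_Ici_self⟩
      have := (h.impact t ht h0 hx.symm).pow 2
      rwa [neg_sq] at this
    · exact (h.flight t ht h0 hx).deriv_u.continuousAt.pow 2

end Motion.IsSolution

/-! ### Monotonicity from right derivatives -/

/-- Two-sided derivatives may fail to exist at contacts; for a continuous function the right
derivative alone yields the mean value inequality. -/
theorem sub_le_of_right_deriv_le {f : ℝ → ℝ} {a b c : ℝ} (hab : a ≤ b)
    (hf : ContinuousOn f (Icc a b))
    (hd : ∀ t ∈ Ico a b, ∃ e, HasDerivWithinAt f e (Ici t) t ∧ e ≤ c) :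
    f b - f a ≤ c * (b - a) := by
  choose! f' hf' using hd
  have h := image_le_of_deriv_right_le_deriv_boundary hf (fun t ht => (hf' t ht).1)
    (B := fun t => f a + c * (t - a)) (B' := fun _ => c) (by simp) (by fun_prop)
    (fun t _ => by
      have := (((hasDerivAt_id t).sub_const a).const_mul c).const_add (f a)
      simpa using this.hasDerivWithinAt)
    (fun t ht => (hf' t ht).2) (right_mem_Icc.2 hab)
  linarith

theorem le_sub_of_le_right_deriv {f : ℝ → ℝ} {a b c : ℝ} (hab : a ≤ b)
    (hf : ContinuousOn f (Icc a b))
    (hd : ∀ t ∈ Ico a b, ∃ e, HasDerivWithinAt f e (Ici t) t ∧ c ≤ e) :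
    c * (b - a) ≤ f b - f a := by
  have := sub_le_of_right_deriv_le (f := fun t => -f t) (c := -c) hab hf.neg (fun t ht => by
    obtain ⟨e, he, hc⟩ := hd t ht
    exact ⟨-e, he.neg, neg_le_neg hc⟩)
  linarith

theorem abs_sub_le_of_right_deriv {f : ℝ → ℝ} {a b c : ℝ} (hab : a ≤ b)
    (hf : ContinuousOn f (Icc a b))
    (hd : ∀ t ∈ Ico a b, ∃ e, HasDerivWithinAt f e (Ici t) t ∧ |e| ≤ c) :
    |f b - f a| ≤ c * (b - a) := by
  refine abs_le.2 ⟨?_, ?_⟩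
  · have := le_sub_of_le_right_deriv (c := -c) hab hf (fun t ht => by
      obtain ⟨e, he, hc⟩ := hd t ht
      exact ⟨e, he, (abs_le.1 hc).1⟩)
    linarith
  · exact sub_le_of_right_deriv_le hab hf (fun t ht => by
      obtain ⟨e, he, hc⟩ := hd t ht
      exact ⟨e, he, (abs_le.1 hc).2⟩)

/-! ### Energy -/

/-- The mechanical energy. -/
noncomputable def Motion.energy (γ : ℝ) (m : Motion) (t : ℝ) : ℝ :=
  m.u t ^ 2 / 2 + m.v t ^ 2 / 2 + γ * (m.x t + m.y t) + (m.y t - m.x t - 1) ^ 2 / 4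

/-- Completing the square in the spring length turns the linear gravity term into `2 γ x`,
nonnegative along a solution, so the energy is coercive. -/
theorem Motion.energy_lower_bound (γ : ℝ) (m : Motion) (t : ℝ) :
    m.u t ^ 2 / 2 + m.v t ^ 2 / 2 + 2 * γ * m.x t + ((m.y t - m.x t - 1) / 2 + γ) ^ 2
      + (γ - γ ^ 2) = m.energy γ t := by
  unfold Motion.energy; ring

namespace Motion.IsSolution

variable {γ μ : ℝ} {T : EReal} {m : Motion}

theorem sq_u_deriv (h : m.IsSolution γ μ T) {t : ℝ} (ht : t ∈ timeDomain T) :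
    HasDerivWithinAt (fun s => m.u s ^ 2) (2 * m.u t * m.lowerAcc γ μ t) (Ici t) t := by
  obtain ⟨a, ha, hc⟩ := h.u_deriv ht
  refine (ha.fun_pow 2).congr_deriv ?_
  rcases hc with rfl | ⟨rfl, -, hu⟩
  · simp
  · simp [hu]

theorem energy_continuousOn (h : m.IsSolution γ μ T) :
    ContinuousOn (m.energy γ) (timeDomain T) := by
  have h1 := h.sq_u_continuousOn
  have h2 := h.x_cont
  have h3 := h.y_cont
  have h4 := h.v_cont
  unfold Motion.energy
  fun_prop

theorem energy_deriv (h : m.IsSolution γ μ T) {t : ℝ} (ht : t ∈ timeDomain T) :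
    HasDerivWithinAt (m.energy γ) (-(μ * (m.v t - m.u t) ^ 2)) (Ici t) t := by
  have h1 := h.sq_u_deriv ht
  have h2 := h.x_deriv ht
  have h3 := h.y_deriv ht
  have h4 := h.v_deriv ht
  refine ((((h1.div_const 2).add ((h4.fun_pow 2).div_const 2)).add
    ((h2.add h3).const_mul γ)).add ((((h3.sub h2).sub_const 1).fun_pow 2).div_const 4)).congr_deriv ?_
  simp only [Motion.lowerAcc, Motion.upperAcc, Pi.sub_apply]
  push_cast
  ring

theorem energy_antitone (hμ : 0 ≤ μ) (h : m.IsSolution γ μ T) {a b : ℝ} (ha : 0 ≤ a)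
    (hab : a ≤ b) (hb : b ∈ timeDomain T) : m.energy γ b ≤ m.energy γ a := by
  have := sub_le_of_right_deriv_le (c := 0) hab
    (h.energy_continuousOn.mono (Icc_subset_timeDomain ha hb)) (fun t ht =>
      ⟨_, h.energy_deriv (Icc_subset_timeDomain ha hb (Ico_subset_Icc_self ht)),
        neg_nonpos.2 (by positivity)⟩)
  linarith

theorem exists_bound (hγ : 0 < γ) (hμ : 0 ≤ μ) (h : m.IsSolution γ μ T) :
    ∃ M > 0, ∀ t ∈ timeDomain T, |m.x t| ≤ M ∧ |m.u t| ≤ M ∧ |m.y t| ≤ M ∧ |m.v t| ≤ M := by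
  set C := |m.energy γ 0 - (γ - γ ^ 2)| with hC
  have hC0 : 0 ≤ C := abs_nonneg _
  refine ⟨4 * C + 4 + 2 * γ + C / γ, by positivity, fun t ht => ?_⟩
  have hE := h.energy_antitone hμ le_rfl ht.1 ht
  rw [← m.energy_lower_bound γ t] at hE
  have hle := le_abs_self (m.energy γ 0 - (γ - γ ^ 2))
  rw [← hC] at hle
  have hx := h.x_nonneg t ht
  have hγx : 0 ≤ γ * m.x t := by positivity
  have hx2 : m.x t ≤ C / γ := by
    rw [le_div_iff₀ hγ]
    nlinarith [sq_nonneg (m.u t), sq_nonneg (m.v t), sq_nonneg ((m.y t - m.x t - 1) / 2 + γ)]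
  have hu : m.u t ^ 2 ≤ 2 * C := by
    nlinarith [sq_nonneg (m.u t), sq_nonneg (m.v t), sq_nonneg ((m.y t - m.x t - 1) / 2 + γ)]
  have hv : m.v t ^ 2 ≤ 2 * C := by
    nlinarith [sq_nonneg (m.u t), sq_nonneg (m.v t), sq_nonneg ((m.y t - m.x t - 1) / 2 + γ)]
  have hd : ((m.y t - m.x t - 1) / 2 + γ) ^ 2 ≤ C := by
    nlinarith [sq_nonneg (m.u t), sq_nonneg (m.v t), sq_nonneg ((m.y t - m.x t - 1) / 2 + γ)]
  have hCγ : 0 ≤ C / γ := by positivity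
  have hd' : |(m.y t - m.x t - 1) / 2 + γ| ≤ C + 1 := abs_le_of_sq_le_sq (by nlinarith) (by linarith)
  have hu' : |m.u t| ≤ C + 1 := abs_le_of_sq_le_sq (by nlinarith) (by linarith)
  have hv' : |m.v t| ≤ C + 1 := abs_le_of_sq_le_sq (by nlinarith) (by linarith)
  have h4 := abs_le.1 hd'
  refine ⟨abs_le.2 ⟨by linarith, by linarith⟩, by linarith, abs_le.2 ⟨by linarith, by linarith⟩,
    by linarith⟩

/-- The speed, unlike the velocity, passes through impacts continuously, so an acceleration bound is
a Lipschitz bound for it. -/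
theorem abs_abs_u_sub_le (h : m.IsSolution γ μ T) {a b K : ℝ} (ha : 0 ≤ a) (hab : a ≤ b)
    (hb : b ∈ timeDomain T) (hK : ∀ t ∈ Ico a b, |m.lowerAcc γ μ t| ≤ K) :
    |(|m.u b| - |m.u a|)| ≤ K * (b - a) := by
  -- The regularisation by `ε` avoids the square root's singularity at `u = 0`; the bound is uniform
  -- in `ε`, which then tends to `0`.
  have key : ∀ ε > 0, |√(m.u b ^ 2 + ε) - √(m.u a ^ 2 + ε)| ≤ K * (b - a) := by
    intro ε hε
    refine abs_sub_le_of_right_deriv (f := fun t => √(m.u t ^ 2 + ε)) hab ?_ fun t ht => ?_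
    · exact ((h.sq_u_continuousOn.mono (Icc_subset_timeDomain ha hb)).add
        continuousOn_const).sqrt
    · have htD := Icc_subset_timeDomain ha hb (Ico_subset_Icc_self ht)
      refine ⟨_, ((h.sq_u_deriv htD).add_const ε).sqrt (by positivity), ?_⟩
      have hs : |m.u t| ≤ √(m.u t ^ 2 + ε) := Real.abs_le_sqrt (by linarith)
      have hpos : 0 < √(m.u t ^ 2 + ε) := Real.sqrt_pos.2 (by positivity)
      rw [abs_div, abs_mul, abs_mul, abs_of_pos (by positivity : 0 < 2 * √(m.u t ^ 2 + ε)),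
        div_le_iff₀ (by positivity), abs_two]
      have := mul_le_mul hs (hK t ht) (abs_nonneg _) hpos.le
      linarith
  have hlim : ∀ w : ℝ, Tendsto (fun ε => √(w ^ 2 + ε)) (𝓝[>] 0) (𝓝 |w|) := by
    intro w
    have : Tendsto (fun ε => √(w ^ 2 + ε)) (𝓝 0) (𝓝 (√(w ^ 2 + 0))) :=
      Continuous.tendsto (by fun_prop) 0
    rw [add_zero, Real.sqrt_sq_eq_abs] at this
    exact this.mono_left nhdsWithin_le_nhds
  exact le_of_tendsto ((hlim _).sub (hlim _)).abs
    (by filter_upwards [self_mem_nhdsWithin] with ε hε using key ε hε)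

end Motion.IsSolution

namespace Motion.IsSolution

variable {γ μ : ℝ} {T : EReal} {m : Motion}

/-! ### Lipschitz bounds -/

theorem x_lipschitz (h : m.IsSolution γ μ T) {M : ℝ} (hM : ∀ t ∈ timeDomain T, |m.u t| ≤ M)
    {a b : ℝ} (ha : 0 ≤ a) (hab : a ≤ b) (hb : b ∈ timeDomain T) :
    |m.x b - m.x a| ≤ M * (b - a) :=
  abs_sub_le_of_right_deriv hab (h.x_cont.mono (Icc_subset_timeDomain ha hb)) fun t ht =>
    have htD := Icc_subset_timeDomain ha hb (Ico_subset_Icc_self ht)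
    ⟨_, h.x_deriv htD, hM t htD⟩

theorem abs_lowerAcc_le (hγ : 0 < γ) (hμ : 0 ≤ μ) {M : ℝ} {t : ℝ}
    (hM : |m.x t| ≤ M ∧ |m.u t| ≤ M ∧ |m.y t| ≤ M ∧ |m.v t| ≤ M) :
    |m.lowerAcc γ μ t| ≤ γ + 1 / 2 + M + 2 * μ * M := by
  obtain ⟨h1, h2, h3, h4⟩ := hM
  rw [abs_le] at *
  unfold Motion.lowerAcc
  constructor <;> nlinarith

theorem abs_upperAcc_le (hγ : 0 < γ) (hμ : 0 ≤ μ) {M : ℝ} {t : ℝ}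
    (hM : |m.x t| ≤ M ∧ |m.u t| ≤ M ∧ |m.y t| ≤ M ∧ |m.v t| ≤ M) :
    |m.upperAcc γ μ t| ≤ γ + 1 / 2 + M + 2 * μ * M := by
  obtain ⟨h1, h2, h3, h4⟩ := hM
  rw [abs_le] at *
  unfold Motion.upperAcc
  constructor <;> nlinarith

theorem floorForce_continuousOn (h : m.IsSolution γ μ T) :
    ContinuousOn (m.floorForce γ μ) (timeDomain T) := by
  have h3 := h.y_cont
  have h4 := h.v_cont
  unfold Motion.floorForce
  fun_prop

theorem floorForce_deriv (h : m.IsSolution γ μ T) {t : ℝ} (ht : t ∈ timeDomain T) :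
    HasDerivWithinAt (m.floorForce γ μ) (m.v t / 2 + μ * m.upperAcc γ μ t) (Ici t) t := by
  have h3 := h.y_deriv ht
  have h4 := h.v_deriv ht
  exact ((((h3.div_const 2).add (h4.const_mul μ)).sub_const γ).sub_const (1 / 2))

/-! ### Grazings -/

/-- If a continuous contact followed, the right derivative of `u` would be `0`. So flight follows,
where the acceleration at `x = u = 0` is the floor force. -/
theorem floorForce_pos_of_grazing (h : m.IsSolution γ μ T) {t : ℝ} (ht : t ∈ m.grazings T) :
    0 < m.floorForce γ μ t := by
  obtain ⟨htD, hx, hu, a, ha, hpos⟩ := ht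
  have ha' := ha.mono_of_mem_nhdsWithin (timeDomain_mem_nhdsGE htD)
  have huniq := uniqueDiffWithinAt_Ici t
  rcases h.right_dichotomy htD with h1 | ⟨-, -, h1⟩
  · have := huniq.eq_deriv _ ha' (h.u_deriv_of_flight htD h1)
    rw [this] at hpos
    simp only [Motion.lowerAcc, hx, hu] at hpos
    unfold Motion.floorForce
    linarith
  · have := huniq.eq_deriv _ ha' (h.u_deriv_of_stuck htD h1)
    exact absurd this hpos.ne'

theorem notMem_grazings_of_stuck {t : ℝ} (ht : t ∈ timeDomain T) (h0 : 0 < t)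
    (hs : ∀ᶠ s in 𝓝 t, m.StuckAt γ μ s) : t ∉ m.grazings T := by
  rintro ⟨-, -, -, a, ha, hpos⟩
  have h1 : HasDerivAt m.u a t := ha.hasDerivAt (timeDomain_mem_nhds ht h0)
  have h2 : HasDerivAt m.u 0 t := (hasDerivAt_const t (0 : ℝ)).congr_of_eventuallyEq
    (by filter_upwards [hs] with s hs using hs.u_eq)
  exact hpos.ne' (h1.unique h2)

/-- Each side of `t` is locally pure flight or pure contact, and neither contains a grazing. With
compactness this reduces finiteness to a bound on the grazing times strictly inside the domain. -/
theorem eventually_notMem_grazings (h : m.IsSolution γ μ T) {t : ℝ} (ht : t ∈ timeDomain T) :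
    ∀ᶠ s in 𝓝[≠] t, s ∉ m.grazings T := by
  have hflight : ∀ s, 0 < m.x s → s ∉ m.grazings T := fun s hs hg => hs.ne' hg.2.1
  rw [← Iio_union_Ioi, nhdsWithin_union, eventually_sup]
  constructor
  · rcases ht.1.eq_or_lt with h0 | h0
    · subst h0
      filter_upwards [self_mem_nhdsWithin] with s hs hg
      exact absurd hg.1.1 (not_le.2 hs)
    · have hstuck : (∀ᶠ s in 𝓝[<] t, m.StuckAt γ μ s) → ∀ᶠ s in 𝓝[<] t, s ∉ m.grazings T := by
        intro h1
        obtain ⟨b, hb, hsub⟩ := mem_nhdsLT_iff_exists_Ioo_subset.1 h1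
        filter_upwards [Ioo_mem_nhdsLT hb, nhdsWithin_le_nhds (lt_mem_nhds h0)] with s hs hs0
        exact notMem_grazings_of_stuck (timeDomain_of_le ht (le_of_lt hs0) hs.2.le) hs0
          (by filter_upwards [isOpen_Ioo.mem_nhds hs] with r hr using hsub hr)
      rcases (h.x_nonneg t ht).eq_or_lt with hx | hx
      · rcases h.before_contact t ht h0 hx.symm with h1 | h1
        · filter_upwards [h1] with s hs using hflight s hs
        · exact hstuck h1
      · filter_upwards [nhdsWithin_le_nhds
          ((h.x_continuousAt ht h0).eventually (lt_mem_nhds hx))] with s hs using hflight s hs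
  · rcases h.right_dichotomy ht with h1 | ⟨-, -, h1⟩
    · filter_upwards [h1] with s hs using hflight s hs
    · obtain ⟨b, hb, hsub⟩ := mem_nhdsGT_iff_exists_Ioo_subset.1 h1
      filter_upwards [Ioo_mem_nhdsGT hb, nhdsWithin_mono t Ioi_subset_Ici_self
        (timeDomain_mem_nhdsGE ht)] with s hs hsD
      exact notMem_grazings_of_stuck hsD (lt_of_le_of_lt ht.1 hs.1)
        (by filter_upwards [isOpen_Ioo.mem_nhds hs] with r hr using hsub hr)

theorem grazings_finite_of_bounded (h : m.IsSolution γ μ T) {S : ℝ} (hS : S ∈ timeDomain T)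
    (hle : ∀ t ∈ m.grazings T, t ≤ S) : (m.grazings T).Finite := by
  by_contra hinf
  have hsub : m.grazings T ⊆ Icc 0 S := fun t ht => ⟨ht.1.1, hle t ht⟩
  obtain ⟨t, ht, hacc⟩ := Set.Infinite.exists_accPt_of_subset_isCompact hinf isCompact_Icc hsub
  have := h.eventually_notMem_grazings (Icc_subset_timeDomain le_rfl hS ht)
  rw [accPt_iff_frequently_nhdsNE] at hacc
  exact hacc this

/-- A contact with zero velocity and nonnegative force dissipates a definite amount of energy
around it. -/
theorem exists_energy_drop (hγ : 0 < γ) (hμ : 0 < μ) (h : m.IsSolution γ μ T) :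
    ∃ δ > 0, ∃ ε > 0, ∀ t, δ ≤ t → t + δ ∈ timeDomain T → m.x t = 0 → m.u t = 0 →
      0 ≤ m.floorForce γ μ t → m.energy γ (t + δ) + ε ≤ m.energy γ (t - δ) := by
  obtain ⟨M, hM0, hM⟩ := h.exists_bound hγ hμ.le
  set A := γ + 1 / 2 + M + 2 * μ * M with hA
  have hA0 : 0 < A := by positivity
  -- Chosen so that, within `δ` of the contact, the changes of the force, of `μ u` and of `x / 2`
  -- together move the lower acceleration by at most `γ / 2`.
  set δ := γ / (2 * (M + 2 * μ * A)) with hδ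
  have hδ0 : 0 < δ := by positivity
  have hδe : (M + 2 * μ * A) * δ = γ / 2 := by
    rw [hδ]; field_simp
  refine ⟨δ, hδ0, μ * (γ * (δ / 2)) ^ 2 * (δ / 2), by positivity,
    fun t₀ ht₀ htD hx hu hF => ?_⟩
  have ht0 : 0 ≤ t₀ := hδ0.le.trans ht₀
  have hD : ∀ s ∈ Icc (t₀ - δ) (t₀ + δ), s ∈ timeDomain T :=
    Icc_subset_timeDomain (by linarith) htD
  have ht₀D : t₀ ∈ timeDomain T := hD _ ⟨by linarith, by linarith⟩
  have hR : ∀ s, m.lowerAcc γ μ s = m.floorForce γ μ s - μ * m.u s - m.x s / 2 := fun s => by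
    simp only [Motion.lowerAcc, Motion.floorForce]; ring
  -- Internal forces cancel in the sum of the two accelerations. This is what makes the upper mass
  -- decelerate faster, by `γ`, than `|u|` can change.
  have hUp : ∀ s, m.upperAcc γ μ s = -2 * γ - m.lowerAcc γ μ s := fun s => by
    simp only [Motion.lowerAcc, Motion.upperAcc]; ring
  have hub : ∀ t ∈ timeDomain T, |m.u t| ≤ M := fun t ht => (hM t ht).2.1
  have hFl : ∀ a b, 0 ≤ a → a ≤ b → b ∈ timeDomain T →
      |m.floorForce γ μ b - m.floorForce γ μ a| ≤ (M / 2 + μ * A) * (b - a) := by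
    intro a b ha hab hb
    refine abs_sub_le_of_right_deriv hab
      (h.floorForce_continuousOn.mono (Icc_subset_timeDomain ha hb)) fun t ht => ?_
    have htD := Icc_subset_timeDomain ha hb (Ico_subset_Icc_self ht)
    refine ⟨_, h.floorForce_deriv htD, ?_⟩
    have h1 := (hM t htD).2.2.2
    have h2 := abs_upperAcc_le hγ hμ.le (hM t htD)
    rw [← hA] at h2
    rw [abs_le] at *
    constructor <;> nlinarith
  have hul : ∀ a b, 0 ≤ a → a ≤ b → b ∈ timeDomain T → |(|m.u b| - |m.u a|)| ≤ A * (b - a) :=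
    fun a b ha hab hb => h.abs_abs_u_sub_le ha hab hb fun t ht =>
      abs_lowerAcc_le hγ hμ.le (hM t (Icc_subset_timeDomain ha hb (Ico_subset_Icc_self ht)))
  have hacc : ∀ s ∈ Icc (t₀ - δ) (t₀ + δ),
      |m.lowerAcc γ μ s - m.floorForce γ μ t₀| ≤ γ / 2 := by
    intro s hs
    have hsD := hD s hs
    have key : |m.x s| ≤ M * δ ∧ |m.floorForce γ μ s - m.floorForce γ μ t₀| ≤
        (M / 2 + μ * A) * δ ∧ |m.u s| ≤ A * δ := by
      rcases le_total s t₀ with hst | hst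
      · have e1 := h.x_lipschitz hub hsD.1 hst ht₀D
        have e2 := hFl s t₀ hsD.1 hst ht₀D
        have e3 := hul s t₀ hsD.1 hst ht₀D
        rw [hx, zero_sub, abs_neg] at e1
        rw [hu, abs_zero, zero_sub, abs_neg, abs_abs] at e3
        rw [abs_sub_comm] at e2
        refine ⟨e1.trans ?_, e2.trans ?_, e3.trans ?_⟩ <;>
        exact mul_le_mul_of_nonneg_left (by linarith [hs.1]) (by positivity)
      · have e1 := h.x_lipschitz hub ht0 hst hsD
        have e2 := hFl t₀ s ht0 hst hsD
        have e3 := hul t₀ s ht0 hst hsD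
        rw [hx, sub_zero] at e1
        rw [hu, abs_zero, sub_zero, abs_abs] at e3
        refine ⟨e1.trans ?_, e2.trans ?_, e3.trans ?_⟩ <;>
        exact mul_le_mul_of_nonneg_left (by linarith [hs.2]) (by positivity)
    obtain ⟨e1, e2, e3⟩ := key
    have e4 : |μ * m.u s| ≤ μ * (A * δ) := by
      rw [abs_mul, abs_of_pos hμ]
      exact mul_le_mul_of_nonneg_left e3 hμ.le
    rw [hR]
    rw [abs_le] at *
    constructor <;> nlinarith
  set K := m.floorForce γ μ t₀ + γ / 2 with hK
  have hlow : ∀ s ∈ Icc (t₀ - δ) (t₀ + δ), |m.lowerAcc γ μ s| ≤ K := fun s hs => by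
    have := abs_le.1 (hacc s hs)
    exact abs_le.2 ⟨by linarith, by linarith⟩
  have hupp : ∀ s ∈ Icc (t₀ - δ) (t₀ + δ), m.upperAcc γ μ s ≤ -(K + γ) := fun s hs => by
    have := abs_le.1 (hacc s hs)
    rw [hUp]
    linarith
  have hvc := fun a b (ha : t₀ - δ ≤ a) (hab : a ≤ b) (hb : b ≤ t₀ + δ) =>
    sub_le_of_right_deriv_le (c := -(K + γ)) hab
      (h.v_cont.mono fun t ht => hD t ⟨ha.trans ht.1, ht.2.trans hb⟩) fun t ht =>
      ⟨_, h.v_deriv (hD t ⟨ha.trans ht.1, ht.2.le.trans hb⟩),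
        hupp t ⟨ha.trans ht.1, ht.2.le.trans hb⟩⟩
  have huc := fun a b (ha : t₀ - δ ≤ a) (hab : a ≤ b) (hb : b ≤ t₀ + δ) =>
    h.abs_abs_u_sub_le (K := K) (by linarith) hab (hD b ⟨by linarith, hb⟩)
      fun t ht => hlow t ⟨ha.trans ht.1, ht.2.le.trans hb⟩
  have hdrop : ∀ a b, t₀ - δ ≤ a → a + δ / 2 = b → b ≤ t₀ + δ →
      (∀ t ∈ Icc a b, γ * (δ / 2) ≤ |m.v t - m.u t|) →
      m.energy γ b + μ * (γ * (δ / 2)) ^ 2 * (δ / 2) ≤ m.energy γ a := by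
    intro a b ha hab hb hd
    have := sub_le_of_right_deriv_le (a := a) (b := b) (c := -(μ * (γ * (δ / 2)) ^ 2))
      (by linarith)
      (h.energy_continuousOn.mono fun t ht => hD t ⟨ha.trans ht.1, ht.2.trans hb⟩) fun t ht =>
      ⟨_, h.energy_deriv (hD t ⟨ha.trans ht.1, ht.2.le.trans hb⟩), by
        have := hd t (Ico_subset_Icc_self ht)
        rw [← sq_abs (m.v t - m.u t)]
        gcongr⟩
    have hba : b - a = δ / 2 := by linarith
    rw [hba] at this
    linarith
  -- Since `v` decreases, use the side on which it moves away from `0`: after `t₀` if `v t₀ ≤ 0`,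
  -- before it otherwise. On the outer half of that side `|v - u| ≥ γ δ / 2`.
  rcases le_total (m.v t₀) 0 with hv | hv
  · have h1 := hdrop (t₀ + δ / 2) (t₀ + δ) (by linarith) (by ring) le_rfl fun t ht => by
      have e1 := hvc t₀ t (by linarith) (by linarith [ht.1]) ht.2
      have e2 := huc t₀ t (by linarith) (by linarith [ht.1]) ht.2
      rw [hu, abs_zero, sub_zero, abs_abs] at e2
      have e3 := abs_le.1 e2
      have e4 := mul_le_mul_of_nonneg_left (by linarith [ht.1] : δ / 2 ≤ t - t₀) hγ.le
      refine le_trans ?_ (neg_le_abs _)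
      linarith
    have h2 := h.energy_antitone hμ.le (a := t₀ - δ) (b := t₀ + δ / 2) (by linarith)
      (by linarith) (hD _ ⟨by linarith, by linarith⟩)
    linarith
  · have h1 := hdrop (t₀ - δ) (t₀ - δ / 2) le_rfl (by ring) (by linarith) fun t ht => by
      have e1 := hvc t t₀ ht.1 (by linarith [ht.2]) (by linarith)
      have e2 := huc t t₀ ht.1 (by linarith [ht.2]) (by linarith)
      rw [hu, abs_zero, zero_sub, abs_neg, abs_abs] at e2
      have e3 := abs_le.1 e2
      have e4 := mul_le_mul_of_nonneg_left (by linarith [ht.2] : δ / 2 ≤ t₀ - t) hγ.le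
      refine le_trans ?_ (le_abs_self _)
      linarith
    have h2 := h.energy_antitone hμ.le (a := t₀ - δ / 2) (b := t₀ + δ) (by linarith)
      (by linarith) htD
    linarith

theorem grazings_finite_of_top (hγ : 0 < γ) (hμ : 0 < μ) (h : m.IsSolution γ μ ⊤) :
    (m.grazings ⊤).Finite := by
  have hD : ∀ t : ℝ, 0 ≤ t → t ∈ timeDomain ⊤ := fun t ht => ⟨ht, EReal.coe_lt_top t⟩
  suffices hb : ∃ S, 0 ≤ S ∧ ∀ t ∈ m.grazings ⊤, t ≤ S by
    obtain ⟨S, hS, hle⟩ := hb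
    exact h.grazings_finite_of_bounded (hD S hS) hle
  by_contra! hub
  obtain ⟨δ, hδ, ε, hε, hdrop⟩ := h.exists_energy_drop hγ hμ
  -- Unbounded grazing times allow infinitely many disjoint windows, each costing `ε`, against the
  -- lower bound of the energy.
  have hseq : ∀ n : ℕ, ∃ t, 0 ≤ t ∧ m.energy γ t ≤ m.energy γ 0 - n * ε := by
    intro n
    induction n with
    | zero => exact ⟨0, le_rfl, by simp⟩
    | succ n ih =>
      obtain ⟨t, ht, hle⟩ := ih
      obtain ⟨s, hs, hts⟩ := hub (t + δ) (by linarith)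
      have h1 := hdrop s (by linarith) (hD _ (by linarith)) hs.2.1 hs.2.2.1
        (h.floorForce_pos_of_grazing hs).le
      have h2 := h.energy_antitone hμ.le ht (by linarith : t ≤ s - δ) (hD _ (by linarith))
      refine ⟨s + δ, by linarith, ?_⟩
      push_cast
      linarith
  obtain ⟨n, hn⟩ := exists_nat_gt ((m.energy γ 0 - (γ - γ ^ 2)) / ε)
  rw [div_lt_iff₀ hε] at hn
  obtain ⟨t, ht, hle⟩ := hseq n
  have hx := h.x_nonneg t (hD t ht)
  have := m.energy_lower_bound γ t
  have hp : 0 ≤ m.u t ^ 2 / 2 + m.v t ^ 2 / 2 + 2 * γ * m.x t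
    + ((m.y t - m.x t - 1) / 2 + γ) ^ 2 := by positivity
  linarith

end Motion.IsSolution

/-! ### Behaviour at the right end of an interval -/

theorem mem_timeDomain_coe {T t : ℝ} : t ∈ timeDomain (T : EReal) ↔ 0 ≤ t ∧ t < T := by
  simp [timeDomain]

theorem exists_left_limit {f : ℝ → ℝ} {s T K : ℝ} (hT : s < T)
    (hf : ∀ a b, s ≤ a → a ≤ b → b < T → |f b - f a| ≤ K * (b - a)) :
    ∃ l, Tendsto f (𝓝[<] T) (𝓝 l) := by
  have hK : ∀ a b, s ≤ a → a ≤ b → b < T → |f b - f a| ≤ K.toNNReal * (b - a) :=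
    fun a b ha hab hb => (hf a b ha hab hb).trans
      (mul_le_mul_of_nonneg_right (Real.le_coe_toNNReal K) (by linarith))
  have hL : LipschitzOnWith K.toNNReal f (Ico s T) := by
    refine LipschitzOnWith.of_dist_le_mul fun a ha b hb => ?_
    rw [Real.dist_eq, Real.dist_eq]
    rcases le_total a b with hab | hab
    · rw [abs_sub_comm, abs_sub_comm a b, abs_of_nonneg (by linarith : 0 ≤ b - a)]
      exact hK a b ha.1 hab hb.2
    · rw [abs_of_nonneg (by linarith : 0 ≤ a - b)]
      exact hK b a hb.1 hab ha.2
  obtain ⟨g, hg, hfg⟩ := hL.extend_real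
  refine ⟨g T, (hg.continuous.continuousAt.mono_left nhdsWithin_le_nhds).congr' ?_⟩
  filter_upwards [Ioo_mem_nhdsLT hT] with t ht using (hfg ⟨ht.1.le, ht.2⟩).symm

theorem exists_Ioo_of_eventually_left {p : ℝ → Prop} {T s₁ : ℝ} (hs₁ : s₁ < T)
    (hp : ∀ᶠ t in 𝓝[<] T, p t) : ∃ s, s₁ ≤ s ∧ s < T ∧ ∀ t, s < t → t < T → p t := by
  obtain ⟨s, hs, hsub⟩ := mem_nhdsLT_iff_exists_Ioo_subset.1 hp
  exact ⟨max s s₁, le_max_right _ _, max_lt hs hs₁,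
    fun t h1 h2 => hsub ⟨lt_of_le_of_lt (le_max_left _ _) h1, h2⟩⟩

theorem eventually_left_of_forall {p : ℝ → Prop} {T s : ℝ} (hs : s < T)
    (hp : ∀ t, s < t → t < T → p t) : ∀ᶠ t in 𝓝[<] T, p t := by
  filter_upwards [Ioo_mem_nhdsLT hs] with t ht using hp t ht.1 ht.2

/-- Integration backwards from `T`, where `φ` vanishes in the limit; this is how signs of limiting
derivatives are turned into signs just before `T`. -/
theorem eventually_le_of_le_right_deriv {φ ψ : ℝ → ℝ} {T c : ℝ} (hT : 0 < T)
    (hφ : ContinuousOn φ (Ico 0 T))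
    (hd : ∀ t ∈ Ico 0 T, HasDerivWithinAt φ (ψ t) (Ici t) t)
    (hlim : Tendsto φ (𝓝[<] T) (𝓝 0)) (hψ : ∀ᶠ t in 𝓝[<] T, c ≤ ψ t) :
    ∀ᶠ t in 𝓝[<] T, φ t ≤ -(c * (T - t)) := by
  obtain ⟨s, hs0, hsT, hs⟩ := exists_Ioo_of_eventually_left hT hψ
  refine eventually_left_of_forall hsT fun t hst htT => ?_
  have h1 : Tendsto (fun b => φ b - c * (b - t)) (𝓝[<] T) (𝓝 (0 - c * (T - t))) := by
    refine hlim.sub (Tendsto.mono_left ?_ nhdsWithin_le_nhds)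
    exact Continuous.tendsto (by fun_prop) T
  rw [zero_sub] at h1
  refine ge_of_tendsto h1 (eventually_left_of_forall htT fun b htb hbT => ?_)
  have := le_sub_of_le_right_deriv (c := c) htb.le
    (hφ.mono fun r hr => ⟨by linarith [hr.1], by linarith [hr.2]⟩) fun r hr =>
    ⟨_, hd r ⟨by linarith [hr.1], by linarith [hr.2]⟩, hs r (by linarith [hr.1])
      (by linarith [hr.2])⟩
  linarith

theorem eventually_ge_of_right_deriv_le {φ ψ : ℝ → ℝ} {T c : ℝ} (hT : 0 < T)
    (hφ : ContinuousOn φ (Ico 0 T))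
    (hd : ∀ t ∈ Ico 0 T, HasDerivWithinAt φ (ψ t) (Ici t) t)
    (hlim : Tendsto φ (𝓝[<] T) (𝓝 0)) (hψ : ∀ᶠ t in 𝓝[<] T, ψ t ≤ -c) :
    ∀ᶠ t in 𝓝[<] T, c * (T - t) ≤ φ t := by
  have := eventually_le_of_le_right_deriv (φ := fun t => -φ t) (ψ := fun t => -ψ t) (c := c) hT
    hφ.neg (fun t ht => (hd t ht).neg) (by simpa using hlim.neg)
    (by filter_upwards [hψ] with t ht using by linarith)
  filter_upwards [this] with t ht using by linarith

/-! ### The modified force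

Subtracting `μ ^ 2 x` from the force on the lower mass makes its right derivative a continuous
function of time, also at impacts. -/

/-- The modified force on the lower mass. -/
noncomputable def Motion.modForce (γ μ : ℝ) (m : Motion) (t : ℝ) : ℝ :=
  m.floorForce γ μ t - μ ^ 2 * m.x t

/-- The derivative of the modified force. -/
noncomputable def Motion.forceRate (γ μ : ℝ) (m : Motion) (t : ℝ) : ℝ :=
  m.v t / 2 + μ * (1 / 2 - γ + m.x t / 2 - μ * m.v t - m.y t / 2)

/-- The modified derivative of the modified force. -/
noncomputable def Motion.modForceRate (γ μ : ℝ) (m : Motion) (t : ℝ) : ℝ :=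
  m.forceRate γ μ t - (μ - μ ^ 3) * m.x t

/-- The derivative of `modForceRate`. -/
noncomputable def Motion.forceRateRate (γ μ : ℝ) (m : Motion) (t : ℝ) : ℝ :=
  (1 / 2 - μ ^ 2) * (1 / 2 - γ + m.x t / 2 - μ * m.v t - m.y t / 2) - μ * m.v t / 2

theorem Motion.lowerAcc_eq (γ μ : ℝ) (m : Motion) (t : ℝ) :
    m.lowerAcc γ μ t = m.modForce γ μ t - μ * m.u t - (1 / 2 - μ ^ 2) * m.x t := by
  simp only [Motion.lowerAcc, Motion.modForce, Motion.floorForce]; ring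

namespace Motion.IsSolution

variable {γ μ : ℝ} {T : EReal} {m : Motion}

theorem modForce_continuousOn (h : m.IsSolution γ μ T) :
    ContinuousOn (m.modForce γ μ) (timeDomain T) :=
  h.floorForce_continuousOn.sub (h.x_cont.const_mul _)

theorem modForceRate_continuousOn (h : m.IsSolution γ μ T) :
    ContinuousOn (m.modForceRate γ μ) (timeDomain T) := by
  have h2 := h.x_cont
  have h3 := h.y_cont
  have h4 := h.v_cont
  unfold Motion.modForceRate Motion.forceRate
  fun_prop

theorem modForce_deriv (h : m.IsSolution γ μ T) {t : ℝ} (ht : t ∈ timeDomain T) :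
    HasDerivWithinAt (m.modForce γ μ) (m.forceRate γ μ t) (Ici t) t := by
  refine ((h.floorForce_deriv ht).sub ((h.x_deriv ht).const_mul (μ ^ 2))).congr_deriv ?_
  simp only [Motion.forceRate, Motion.upperAcc]
  ring

theorem modForceRate_deriv (h : m.IsSolution γ μ T) {t : ℝ} (ht : t ∈ timeDomain T) :
    HasDerivWithinAt (m.modForceRate γ μ) (m.forceRateRate γ μ t) (Ici t) t := by
  have h2 := h.x_deriv ht
  have h3 := h.y_deriv ht
  have h4 := h.v_deriv ht
  refine (((h4.div_const 2).add (((((h2.div_const 2).const_add (1 / 2 - γ)).sub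
    (h4.const_mul μ)).sub (h3.div_const 2)).const_mul μ)).sub
    (h2.const_mul (μ - μ ^ 3))).congr_deriv ?_
  simp only [Motion.forceRateRate, Motion.upperAcc]
  ring

/-! ### Returning to the floor -/

/-- A downward pull of at most `G` can bring the mass back in time `b - a` only if the take-off
velocity is of order `G (b - a)`; with no pull it cannot return at all. -/
theorem return_estimate (hμ : 0 < μ) (h : m.IsSolution γ μ T) {a b G : ℝ} (ha : 0 ≤ a)
    (hab : a < b) (hb : b ∈ timeDomain T) (hxa : m.x a = 0) (hxb : m.x b = 0)
    (hfl : ∀ t ∈ Ioo a b, 0 < m.x t) (hG0 : 0 ≤ G)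
    (hG : ∀ t ∈ Ico a b, -G ≤ m.modForce γ μ t) (hs1 : μ * (b - a) ≤ 1)
    (hs2 : 6 * |1 / 2 - μ ^ 2| * (b - a) ^ 2 ≤ 1) :
    0 < G ∧ m.u a ≤ 6 * G * (b - a) := by
  have hD := Icc_subset_timeDomain ha hb
  obtain ⟨c, hc, hmax⟩ := isCompact_Icc.exists_isMaxOn (nonempty_Icc.2 hab.le) (h.x_cont.mono hD)
  have hX : 0 < m.x c := lt_of_lt_of_le
    (hfl ((a + b) / 2) ⟨by linarith, by linarith⟩) (hmax ⟨by linarith, by linarith⟩)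
  have hca : a < c := lt_of_le_of_ne hc.1 (by rintro rfl; linarith)
  have hcb : c < b := lt_of_le_of_ne hc.2 (by rintro rfl; linarith)
  have hfree : ∀ t ∈ Ioo a b, m.FreeAt γ μ t := fun t ht =>
    h.flight t (hD (Ioo_subset_Icc_self ht)) (lt_of_le_of_lt ha ht.1) (hfl t ht)
  have huc : m.u c = 0 := (hmax.isLocalMax (Icc_mem_nhds hca hcb)).hasDerivAt_eq_zero
    (hfree c ⟨hca, hcb⟩).deriv_x
  set κ := 1 / 2 - μ ^ 2 with hκ
  set X := m.x c with hXdef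
  -- Bound on the deceleration apart from friction, which the factor `exp (μ (r - a)) ≤ e < 3`
  -- removes below. Integrating from `s` to the summit, where `u = 0`, gives `u s ≤ 3 N (b - a)`.
  set N := G + |κ| * X with hN
  have hN0 : 0 ≤ N := by positivity
  have hucont : ContinuousOn m.u (Icc a c) := by
    intro r hr
    rcases hr.1.eq_or_lt with rfl | hra
    · exact (h.u_right_cont _ (hD ⟨le_rfl, hab.le⟩)).mono Icc_subset_Ici_self
    · exact (hfree r ⟨hra, by linarith [hr.2]⟩).deriv_u.continuousAt.continuousWithinAt
  have hud : ∀ r ∈ Ico a c, HasDerivWithinAt m.u (m.lowerAcc γ μ r) (Ici r) r := by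
    intro r hr
    refine h.u_deriv_of_flight (hD ⟨hr.1, by linarith [hr.2]⟩) ?_
    filter_upwards [Ioo_mem_nhdsGT (by linarith [hr.2] : r < b)] with s hs
    exact hfl s ⟨lt_of_le_of_lt hr.1 hs.1, hs.2⟩
  have hu : ∀ s ∈ Icc a c, m.u s ≤ 3 * N * (b - a) := by
    intro s hs
    have hkey := le_sub_of_le_right_deriv (f := fun r => Real.exp (μ * (r - a)) * m.u r)
      (c := -(3 * N)) hs.2
      (ContinuousOn.mul (by fun_prop) (hucont.mono (Icc_subset_Icc_left hs.1))) fun r hr => by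
        have hr' : r ∈ Ico a c := ⟨hs.1.trans hr.1, hr.2⟩
        have he : HasDerivAt (fun r => Real.exp (μ * (r - a)))
            (Real.exp (μ * (r - a)) * (μ * 1)) r :=
          (((hasDerivAt_id r).sub_const a).const_mul μ).exp
        refine ⟨_, he.hasDerivWithinAt.mul (hud r hr'), ?_⟩
        have hle : Real.exp (μ * (r - a)) ≤ 3 := by
          refine le_trans (Real.exp_le_exp.2 (?_ : μ * (r - a) ≤ 1)) Real.exp_one_lt_three.le
          refine le_trans (mul_le_mul_of_nonneg_left ?_ hμ.le) hs1
          linarith [hr'.2]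
        have hxr0 := h.x_nonneg r (hD ⟨hr'.1, by linarith [hr'.2]⟩)
        have hxr : m.x r ≤ X := hmax ⟨hr'.1, by linarith [hr'.2]⟩
        have hfr := hG r ⟨hr'.1, by linarith [hr'.2]⟩
        have hκx : κ * m.x r ≤ |κ| * X :=
          (mul_le_mul_of_nonneg_right (le_abs_self κ) hxr0).trans
            (mul_le_mul_of_nonneg_left hxr (abs_nonneg κ))
        have h1 : -N ≤ m.modForce γ μ r - κ * m.x r := by linarith
        have h2 := mul_le_mul_of_nonneg_right hle hN0
        have h3 := mul_le_mul_of_nonneg_left h1 (Real.exp_pos (μ * (r - a))).le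
        rw [m.lowerAcc_eq, ← hκ]
        linarith
    simp only [huc, mul_zero, zero_sub] at hkey
    rcases le_or_gt (m.u s) 0 with h0 | h0
    · exact h0.trans (mul_nonneg (by positivity) (by linarith))
    · have he1 : 1 ≤ Real.exp (μ * (s - a)) :=
        Real.one_le_exp (mul_nonneg hμ.le (by linarith [hs.1]))
      have h1 : m.u s ≤ Real.exp (μ * (s - a)) * m.u s := le_mul_of_one_le_left h0.le he1
      have h2 : 3 * N * (c - s) ≤ 3 * N * (b - a) :=
        mul_le_mul_of_nonneg_left (by linarith [hs.1]) (by positivity)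
      linarith
  have hXle := sub_le_of_right_deriv_le (c := 3 * N * (b - a)) hca.le
    (h.x_cont.mono fun r hr => hD ⟨hr.1, hr.2.trans hcb.le⟩) fun r hr =>
    ⟨_, h.x_deriv (hD ⟨hr.1, by linarith [hr.2]⟩), hu r (Ico_subset_Icc_self hr)⟩
  rw [hxa, sub_zero, ← hXdef] at hXle
  set d := b - a with hd
  have hd0 : 0 < d := sub_pos.2 hab
  have hX2 : X ≤ 3 * N * d * d :=
    hXle.trans (mul_le_mul_of_nonneg_left (by linarith) (by positivity))
  -- `N` contains `X` itself; the smallness of `6 |κ| d²` lets half of `X` be absorbed on the left.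
  have hX3 : X ≤ 6 * G * d ^ 2 := by
    have : X * (6 * |κ| * d ^ 2) ≤ X * 1 := mul_le_mul_of_nonneg_left hs2 hX.le
    have e : 3 * N * d * d = 3 * G * d ^ 2 + X * (6 * |κ| * d ^ 2) / 2 := by rw [hN]; ring
    linarith
  refine ⟨?_, ?_⟩
  · rcases hG0.eq_or_lt with rfl | h0
    · simp at hX3
      linarith
    · exact h0
  · refine (hu a ⟨le_rfl, hca.le⟩).trans ?_
    have h1 : |κ| * X ≤ |κ| * (6 * G * d ^ 2) := mul_le_mul_of_nonneg_left hX3 (abs_nonneg κ)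
    have h2 : G * (6 * |κ| * d ^ 2) ≤ G * 1 := mul_le_mul_of_nonneg_left hs2 hG0
    have h3 : N ≤ 2 * G := by linarith
    nlinarith

theorem exists_next_contact (h : m.IsSolution γ μ T) {a b : ℝ} (ha : 0 ≤ a) (hab : a < b)
    (hb : b ∈ timeDomain T) (hxb : m.x b = 0) (hf : ∀ᶠ s in 𝓝[>] a, 0 < m.x s) :
    ∃ c, a < c ∧ c ≤ b ∧ m.x c = 0 ∧ ∀ t ∈ Ioo a c, 0 < m.x t := by
  obtain ⟨e, he, hsub⟩ := mem_nhdsGT_iff_exists_Ioo_subset.1 hf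
  have hae : a < e := he
  have heb : e ≤ b := by
    by_contra hlt
    have : 0 < m.x b := hsub ⟨hab, not_le.1 hlt⟩
    linarith
  have hcont : ContinuousOn m.x (Icc e b) :=
    h.x_cont.mono (Icc_subset_timeDomain (ha.trans hae.le) hb)
  have hK : IsCompact (Icc e b ∩ m.x ⁻¹' {0}) :=
    isCompact_Icc.of_isClosed_subset (hcont.preimage_isClosed_of_isClosed isClosed_Icc
      isClosed_singleton) inter_subset_left
  obtain ⟨c, hc⟩ := hK.exists_isLeast ⟨b, ⟨heb, le_rfl⟩, hxb⟩
  refine ⟨c, by linarith [hc.1.1.1], hc.1.1.2, hc.1.2, fun t ht => ?_⟩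
  rcases lt_or_ge t e with hte | hte
  · exact hsub ⟨ht.1, hte⟩
  · have htb : t ≤ b := ht.2.le.trans hc.1.1.2
    refine lt_of_le_of_ne (h.x_nonneg t (timeDomain_of_le hb (ha.trans ht.1.le) htb)) fun h0 => ?_
    exact absurd (hc.2 ⟨⟨hte, htb⟩, h0.symm⟩) (not_le.2 ht.2)

end Motion.IsSolution

/-! ### No inelastic collapse -/

theorem eventually_mul_sub_lt {T : ℝ} (C : ℝ) {ε : ℝ} (hε : 0 < ε) :
    ∀ᶠ t in 𝓝[<] T, C * (T - t) < ε := by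
  have h : Tendsto (fun t => C * (T - t)) (𝓝 T) (𝓝 (C * (T - T))) :=
    Continuous.tendsto (by fun_prop) T
  rw [sub_self, mul_zero] at h
  exact nhdsWithin_le_nhds (h.eventually (gt_mem_nhds hε))

theorem eventually_Ioo_left {T : ℝ} (hT : 0 < T) : ∀ᶠ t in 𝓝[<] T, 0 < t ∧ t < T := by
  filter_upwards [Ioo_mem_nhdsLT hT] with t ht using ht

theorem eventually_forall_left {p : ℝ → Prop} {T : ℝ} (hp : ∀ᶠ t in 𝓝[<] T, p t) :
    ∀ᶠ a in 𝓝[<] T, ∀ t ∈ Ico a T, p t := by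
  obtain ⟨s, -, hs, h⟩ := exists_Ioo_of_eventually_left (sub_one_lt T) hp
  exact eventually_left_of_forall hs fun a hsa haT t ht => h t (lt_of_lt_of_le hsa ht.1) ht.2

namespace Motion.IsSolution

variable {γ μ T : ℝ} {m : Motion}

theorem mem_of_Ico {t : ℝ} (h0 : 0 ≤ t) (ht : t < T) : t ∈ timeDomain (T : EReal) :=
  mem_timeDomain_coe.2 ⟨h0, ht⟩

/-- As contacts recur before `T`, each flight near `T` ends after less than `T - a`, so the
smallness conditions of `return_estimate` hold automatically. -/
theorem eventually_return_estimate (hμ : 0 < μ) (hT : 0 < T) (h : m.IsSolution γ μ T)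
    (hc : ∃ᶠ a in 𝓝[<] T, m.x a = 0) :
    ∀ᶠ a in 𝓝[<] T, m.x a = 0 → (∀ᶠ s in 𝓝[>] a, 0 < m.x s) → ∀ G, 0 ≤ G →
      (∀ t ∈ Ico a T, -G ≤ m.modForce γ μ t) → 0 < G ∧ m.u a ≤ 6 * G * (T - a) := by
  filter_upwards [eventually_Ioo_left hT, eventually_mul_sub_lt μ one_pos,
    eventually_mul_sub_lt (6 * |1 / 2 - μ ^ 2|) one_pos, eventually_mul_sub_lt 1 one_pos]
    with a ha h1 h2 h3 hxa hfl G hG0 hG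
  have hev : ∀ᶠ b in 𝓝[<] T, b ∈ Ioo a T := Ioo_mem_nhdsLT ha.2
  obtain ⟨b', hxb', hb1, hb2⟩ := (hc.and_eventually hev).exists
  obtain ⟨b, hab, hbb', hxb, hfl'⟩ := h.exists_next_contact ha.1.le hb1
    (mem_of_Ico (ha.1.le.trans hb1.le) hb2) hxb' hfl
  have hbT : b < T := lt_of_le_of_lt hbb' hb2
  have hd : 0 < b - a := sub_pos.2 hab
  have hle : b - a ≤ T - a := by linarith
  have e1 : μ * (b - a) ≤ μ * (T - a) := mul_le_mul_of_nonneg_left hle hμ.le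
  have e2 : 6 * |1 / 2 - μ ^ 2| * (b - a) ^ 2 ≤ 6 * |1 / 2 - μ ^ 2| * (T - a) := by
    refine mul_le_mul_of_nonneg_left ?_ (by positivity)
    nlinarith
  obtain ⟨r1, r2⟩ := h.return_estimate hμ ha.1.le hab (mem_of_Ico (ha.1.le.trans hab.le) hbT) hxa
    hxb hfl' hG0 (fun t ht => hG t ⟨ht.1, ht.2.trans hbT⟩) (by linarith) (by linarith)
  exact ⟨r1, r2.trans (mul_le_mul_of_nonneg_left hle (by positivity))⟩

theorem exists_limits (hγ : 0 < γ) (hμ : 0 < μ) (hT : 0 < T) (h : m.IsSolution γ μ T) :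
    ∃ xs ys vs, Tendsto m.x (𝓝[<] T) (𝓝 xs) ∧ Tendsto m.y (𝓝[<] T) (𝓝 ys) ∧
      Tendsto m.v (𝓝[<] T) (𝓝 vs) := by
  obtain ⟨M, hM0, hM⟩ := h.exists_bound hγ hμ.le
  have hIcc : ∀ {a b : ℝ}, 0 ≤ a → b < T → Icc a b ⊆ timeDomain (T : EReal) :=
    fun ha hb t ht => mem_of_Ico (ha.trans ht.1) (lt_of_le_of_lt ht.2 hb)
  have hx := exists_left_limit (f := m.x) hT fun a b ha hab hb =>
    abs_sub_le_of_right_deriv hab (h.x_cont.mono (hIcc ha hb)) fun t ht =>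
      have htD := hIcc ha hb (Ico_subset_Icc_self ht)
      ⟨_, h.x_deriv htD, (hM t htD).2.1⟩
  have hy := exists_left_limit (f := m.y) hT fun a b ha hab hb =>
    abs_sub_le_of_right_deriv hab (h.y_cont.mono (hIcc ha hb)) fun t ht =>
      have htD := hIcc ha hb (Ico_subset_Icc_self ht)
      ⟨_, h.y_deriv htD, (hM t htD).2.2.2⟩
  have hv := exists_left_limit (f := m.v) hT fun a b ha hab hb =>
    abs_sub_le_of_right_deriv hab (h.v_cont.mono (hIcc ha hb)) fun t ht =>
      have htD := hIcc ha hb (Ico_subset_Icc_self ht)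
      ⟨_, h.v_deriv htD, abs_upperAcc_le hγ hμ.le (hM t htD)⟩
  obtain ⟨xs, hx⟩ := hx
  obtain ⟨ys, hy⟩ := hy
  obtain ⟨vs, hv⟩ := hv
  exact ⟨xs, ys, vs, hx, hy, hv⟩

theorem not_eventually_modForce_pos (hμ : 0 < μ) (hT : 0 < T) (h : m.IsSolution γ μ T)
    (hc : ∃ᶠ a in 𝓝[<] T, m.x a = 0) : ¬ ∀ᶠ t in 𝓝[<] T, 0 < m.modForce γ μ t := by
  intro hf
  obtain ⟨a, hxa, hret, ha, hpos⟩ := (hc.and_eventually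
    ((h.eventually_return_estimate hμ hT hc).and
      ((eventually_Ioo_left hT).and (eventually_forall_left hf)))).exists
  have haD := mem_of_Ico ha.1.le ha.2
  rcases h.right_dichotomy haD with h1 | ⟨-, -, h1⟩
  · exact lt_irrefl _ (hret hxa h1 0 le_rfl fun t ht => by simpa using (hpos t ht).le).1
  · have h2 := h.floorForce_nonpos_of_stuck haD h1
    have h3 := hpos a ⟨le_rfl, ha.2⟩
    rw [Motion.modForce, hxa] at h3
    linarith

/-- Vanishing height excludes the flight alternative on both sides of `t`; the equations at `t`
itself follow by matching one-sided derivatives. -/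
theorem stuckAt_of_rest {T : EReal} (h : m.IsSolution γ μ T) {a b : ℝ} (ha : 0 ≤ a)
    (hb : b ∈ timeDomain T) (hrest : ∀ t ∈ Ioo a b, m.x t = 0) {t : ℝ} (ht : t ∈ Ioo a b) :
    m.StuckAt γ μ t := by
  have h0 : 0 < t := lt_of_le_of_lt ha ht.1
  have htD : t ∈ timeDomain T := timeDomain_of_le hb h0.le ht.2.le
  have hx : m.x t = 0 := hrest t ht
  have hr : ∀ᶠ s in 𝓝[>] t, m.StuckAt γ μ s := by
    refine (h.after_contact t htD hx).resolve_left fun hp => ?_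
    obtain ⟨s, hs1, hs2⟩ := (hp.and (Ioo_mem_nhdsGT ht.2)).exists
    exact hs1.ne' (hrest s ⟨ht.1.trans hs2.1, hs2.2⟩)
  have hl : ∀ᶠ s in 𝓝[<] t, m.StuckAt γ μ s := by
    refine (h.before_contact t htD h0 hx).resolve_left fun hp => ?_
    obtain ⟨s, hs1, hs2⟩ := (hp.and (Ioo_mem_nhdsLT ht.1)).exists
    exact hs1.ne' (hrest s ⟨hs2.1, hs2.2.trans ht.2⟩)
  have hu : m.u t = 0 := by
    rcases h.right_dichotomy htD with hp | ⟨-, hu, -⟩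
    · obtain ⟨s, hs1, hs2⟩ := (hp.and hr).exists
      exact absurd hs2.x_eq hs1.ne'
    · exact hu
  have hyl : HasDerivWithinAt m.y (m.v t) (Iic t) t :=
    hasDerivWithinAt_Iic_of_eventually (f' := m.v) (h.y_continuousAt htD h0).continuousWithinAt
      (by filter_upwards [hl] with s hs using hs.deriv_y)
      ((h.v_continuousAt htD h0).mono_left nhdsWithin_le_nhds)
  have hvl : HasDerivWithinAt m.v (-γ + 1 / 2 - μ * m.v t - m.y t / 2) (Iic t) t := by
    have h1 := h.v_continuousAt htD h0
    have h2 := h.y_continuousAt htD h0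
    refine hasDerivWithinAt_Iic_of_eventually
      (f' := fun s => -γ + 1 / 2 - μ * m.v s - m.y s / 2) h1.continuousWithinAt
      (by filter_upwards [hl] with s hs using hs.deriv_v) (Tendsto.mono_left ?_ nhdsWithin_le_nhds)
    exact ContinuousAt.tendsto (f := fun s => -γ + 1 / 2 - μ * m.v s - m.y s / 2) (by fun_prop)
  refine ⟨hx, hu, hasDerivAt_of_left_right hyl (h.y_deriv htD),
    hasDerivAt_of_left_right hvl ?_, h.floorForce_nonpos_of_stuck htD hr⟩
  refine (h.v_deriv htD).congr_deriv ?_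
  simp [Motion.upperAcc, hx, hu]

/-- The quantity `(u² + x²) / (2 g) + x`, with `g` the downward force, decays at most
exponentially while `g` grows at most exponentially. -/
theorem adiabatic_estimate {K C : ℝ} (hμ : 0 < μ) (h : m.IsSolution γ μ T) {s : ℝ}
    (hs : 0 ≤ s) (hf : ∀ t, s < t → t < T → m.modForce γ μ t < 0 ∧
      -m.forceRate γ μ t ≤ K * -m.modForce γ μ t)
    (hC : C = 2 * μ + |1 / 2 + μ ^ 2| + |K|) {a b : ℝ} (hsa : s < a) (hab : a ≤ b) (hbT : b < T) :
    Real.exp (C * a) * ((m.u a ^ 2 + m.x a ^ 2) / (2 * -m.modForce γ μ a) + m.x a) ≤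
      Real.exp (C * b) * ((m.u b ^ 2 + m.x b ^ 2) / (2 * -m.modForce γ μ b) + m.x b) := by
  have hD : Icc a b ⊆ timeDomain (T : EReal) := fun t ht =>
    mem_of_Ico (hs.trans (hsa.le.trans ht.1)) (lt_of_le_of_lt ht.2 hbT)
  have hg : ∀ t ∈ Icc a b, m.modForce γ μ t < 0 ∧
      -m.forceRate γ μ t ≤ K * -m.modForce γ μ t := fun t ht =>
    hf t (lt_of_lt_of_le hsa ht.1) (lt_of_le_of_lt ht.2 hbT)
  have := le_sub_of_le_right_deriv (c := 0) (f := fun t => Real.exp (C * t) *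
    ((m.u t ^ 2 + m.x t ^ 2) / (2 * -m.modForce γ μ t) + m.x t)) hab ?_ fun t ht => ?_
  · linarith
  · have h1 := h.sq_u_continuousOn.mono hD
    have h2 := h.x_cont.mono hD
    have h3 := h.modForce_continuousOn.mono hD
    refine ContinuousOn.mul (by fun_prop) (ContinuousOn.add (ContinuousOn.div (by fun_prop)
      (by fun_prop) fun t ht => ?_) h2)
    have := (hg t ht).1
    exact ne_of_gt (by linarith)
  · have htI := Ico_subset_Icc_self ht
    have htD := hD htI
    obtain ⟨hneg, hrate⟩ := hg t htI
    have he : HasDerivAt (fun t => Real.exp (C * t)) (Real.exp (C * t) * (C * 1)) t :=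
      ((hasDerivAt_id t).const_mul C).exp
    have hd := he.hasDerivWithinAt.mul ((((h.sq_u_deriv htD).add
      ((h.x_deriv htD).fun_pow 2)).fun_div ((h.modForce_deriv htD).neg.const_mul 2)
        (by simp only [Pi.neg_apply]; exact ne_of_gt (by linarith))).add (h.x_deriv htD))
    refine ⟨_, hd, ?_⟩
    simp only [Pi.add_apply, Pi.neg_apply]
    rw [m.lowerAcc_eq]
    have hx := h.x_nonneg t htD
    set g := -m.modForce γ μ t with hgdef
    have hg0 : 0 < g := by linarith
    have hfg : m.modForce γ μ t = -g := by linarith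
    rw [hfg]
    set r := m.forceRate γ μ t with hr
    set u := m.u t
    set x := m.x t
    set κ' := 1 / 2 + μ ^ 2 with hκ'
    have hE := Real.exp_pos (C * t)
    have hxu : -(u ^ 2 + x ^ 2) / 2 ≤ x * u ∧ x * u ≤ (u ^ 2 + x ^ 2) / 2 := by
      constructor <;> nlinarith [sq_nonneg (u + x), sq_nonneg (u - x)]
    have hκ : -(|κ'| * ((u ^ 2 + x ^ 2) / 2)) ≤ κ' * (x * u) := by
      have h1 : |κ' * (x * u)| ≤ |κ'| * ((u ^ 2 + x ^ 2) / 2) := by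
        rw [abs_mul]
        exact mul_le_mul_of_nonneg_left (abs_le.2 ⟨by linarith [hxu.1], hxu.2⟩) (abs_nonneg _)
      exact (abs_le.1 h1).1
    have hr1 : -r ≤ |K| * g := hrate.trans (mul_le_mul_of_nonneg_right (le_abs_self K) hg0.le)
    have hr2 : (u ^ 2 + x ^ 2) * (-r) ≤ (u ^ 2 + x ^ 2) * (|K| * g) :=
      mul_le_mul_of_nonneg_left hr1 (by positivity)
    -- The gravity part `-u` of the derivative cancels the derivative of the summand `x`. What
    -- remains is friction, a cross term `x u` and the growth of `g`; the summand `x²` is there so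
    -- that the cross term is dominated by `C (u² + x²) / (2 g)`.
    have key : 0 ≤ C * ((u ^ 2 + x ^ 2) / (2 * g) + x) +
        ((2 * u * (-g - μ * u - (1 / 2 - μ ^ 2) * x) + 2 * x * u) * (2 * g) -
          (u ^ 2 + x ^ 2) * (2 * -r)) / (2 * g) ^ 2 + u := by
      have e : C * ((u ^ 2 + x ^ 2) / (2 * g) + x) +
        ((2 * u * (-g - μ * u - (1 / 2 - μ ^ 2) * x) + 2 * x * u) * (2 * g) -
          (u ^ 2 + x ^ 2) * (2 * -r)) / (2 * g) ^ 2 + u =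
          (C * ((u ^ 2 + x ^ 2) * g) + 2 * g * (-μ * u ^ 2 + κ' * (x * u))
            - (u ^ 2 + x ^ 2) * (-r)) / (2 * g ^ 2) + C * x := by
        rw [hκ']
        field_simp
        ring
      rw [e]
      have hC0 : 0 ≤ C := by rw [hC]; positivity
      refine add_nonneg (div_nonneg ?_ (by positivity)) (by positivity)
      have h5 := mul_le_mul_of_nonneg_left hκ (by positivity : 0 ≤ 2 * g)
      have h6 : 0 ≤ μ * g * x ^ 2 := by positivity
      rw [hC]
      nlinarith
    have := mul_nonneg hE.le key
    push_cast
    refine this.trans (le_of_eq ?_)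
    ring

end Motion.IsSolution

/-! ### Exclusion of collapse under a downward force -/

namespace Motion.IsSolution

variable {γ μ T : ℝ} {m : Motion}

theorem abs_modForce_le (hγ : 0 < γ) (hμ : 0 ≤ μ) {M : ℝ} {t : ℝ}
    (hM : |m.x t| ≤ M ∧ |m.u t| ≤ M ∧ |m.y t| ≤ M ∧ |m.v t| ≤ M) :
    |m.modForce γ μ t| ≤ γ + 1 / 2 + M + μ * M + μ ^ 2 * M := by
  obtain ⟨h1, h2, h3, h4⟩ := hM
  have h5 : |μ ^ 2 * m.x t| ≤ μ ^ 2 * M := by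
    rw [abs_mul, abs_of_nonneg (by positivity)]
    exact mul_le_mul_of_nonneg_left h1 (by positivity)
  rw [abs_le] at *
  unfold Motion.modForce Motion.floorForce
  constructor <;> nlinarith

theorem abs_forceRate_le (hγ : 0 < γ) (hμ : 0 ≤ μ) {M : ℝ} {t : ℝ}
    (hM : |m.x t| ≤ M ∧ |m.u t| ≤ M ∧ |m.y t| ≤ M ∧ |m.v t| ≤ M) :
    |m.forceRate γ μ t| ≤ M + μ * (1 / 2 + γ + M + μ * M) := by
  obtain ⟨h1, h2, h3, h4⟩ := hM
  have h5 : |μ * m.v t| ≤ μ * M := by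
    rw [abs_mul, abs_of_nonneg hμ]
    exact mul_le_mul_of_nonneg_left h4 hμ
  have h6 : |μ * (1 / 2 - γ + m.x t / 2 - μ * m.v t - m.y t / 2)| ≤
      μ * (1 / 2 + γ + M + μ * M) := by
    rw [abs_mul, abs_of_nonneg hμ]
    refine mul_le_mul_of_nonneg_left ?_ hμ
    rw [abs_le] at *
    constructor <;> linarith
  rw [abs_le] at *
  unfold Motion.forceRate
  constructor <;> linarith

theorem modForce_growth {K : ℝ} (h : m.IsSolution γ μ T) {a b : ℝ} (ha : 0 ≤ a) (hab : a ≤ b)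
    (hbT : b < T) (hf : ∀ t ∈ Ico a b, -m.forceRate γ μ t ≤ K * -m.modForce γ μ t) :
    -m.modForce γ μ b ≤ Real.exp (K * (b - a)) * -m.modForce γ μ a := by
  have hD : Icc a b ⊆ timeDomain (T : EReal) := fun t ht =>
    mem_of_Ico (ha.trans ht.1) (lt_of_le_of_lt ht.2 hbT)
  have := sub_le_of_right_deriv_le (c := 0)
    (f := fun t => Real.exp (-K * (t - a)) * -m.modForce γ μ t) hab
    (ContinuousOn.mul (by fun_prop) (h.modForce_continuousOn.mono hD).neg) fun t ht => by
      have he : HasDerivAt (fun t => Real.exp (-K * (t - a)))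
          (Real.exp (-K * (t - a)) * (-K * 1)) t :=
        (((hasDerivAt_id t).sub_const a).const_mul (-K)).exp
      refine ⟨_, he.hasDerivWithinAt.mul (h.modForce_deriv (hD (Ico_subset_Icc_self ht))).neg, ?_⟩
      have := mul_le_mul_of_nonneg_left (hf t ht) (Real.exp_pos (-K * (t - a))).le
      linarith
  simp only [sub_self, mul_zero, Real.exp_zero, one_mul, zero_mul] at this
  have h2 : Real.exp (-K * (b - a)) * -m.modForce γ μ b ≤ -m.modForce γ μ a := by linarith
  have h3 := mul_le_mul_of_nonneg_left h2 (Real.exp_pos (K * (b - a))).le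
  rwa [← mul_assoc, ← Real.exp_add, neg_mul, add_neg_cancel, Real.exp_zero, one_mul] at h3

/-- If the mass is ever off the floor near `T`, the adiabatic quantity stays above some `c > 0`, so
contact velocities satisfy `u² ≥ 2 c g` with `g = -f`. Returning before `T` requires `u ≤ 18 g (T -
a)`. As `g` is bounded, these are incompatible close to `T`, even if `g → 0`. -/
theorem eventually_stuck_of_modForce_neg {K : ℝ} (hγ : 0 < γ) (hμ : 0 < μ) (hT : 0 < T)
    (h : m.IsSolution γ μ T) (hc : ∃ᶠ a in 𝓝[<] T, m.x a = 0) (hK : 0 ≤ K)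
    (hf : ∀ᶠ t in 𝓝[<] T, m.modForce γ μ t < 0 ∧
      -m.forceRate γ μ t ≤ K * -m.modForce γ μ t) : ∀ᶠ t in 𝓝[<] T, m.StuckAt γ μ t := by
  obtain ⟨s, hs0, hsT, hs⟩ := exists_Ioo_of_eventually_left hT hf
  by_cases hall : ∀ t, s < t → t < T → m.x t = 0
  · refine eventually_left_of_forall hsT fun t hst htT => ?_
    exact h.stuckAt_of_rest hs0 (b := (t + T) / 2) (mem_of_Ico (by linarith) (by linarith))
      (fun r hr => hall r hr.1 (by linarith [hr.2])) ⟨hst, by linarith⟩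
  exfalso
  push Not at hall
  obtain ⟨t₁, hst₁, ht₁T, hxne⟩ := hall
  have hx₁ : 0 < m.x t₁ :=
    lt_of_le_of_ne (h.x_nonneg t₁ (mem_of_Ico (by linarith) ht₁T)) (Ne.symm hxne)
  obtain ⟨M, hM0, hM⟩ := h.exists_bound hγ hμ.le
  set B := γ + 1 / 2 + M + μ * M + μ ^ 2 * M with hB
  set C := 2 * μ + |1 / 2 + μ ^ 2| + |K| with hC
  have hC0 : 0 ≤ C := by positivity
  set c₀ := Real.exp (C * t₁) *
    ((m.u t₁ ^ 2 + m.x t₁ ^ 2) / (2 * -m.modForce γ μ t₁) + m.x t₁) with hc₀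
  have hc₀pos : 0 < c₀ := by
    have := (hs t₁ hst₁ ht₁T).1
    have h2 : 0 < 2 * -m.modForce γ μ t₁ := by linarith
    positivity
  set c := c₀ / Real.exp (C * T) with hcdef
  have hcpos : 0 < c := by positivity
  have hev : ∀ᶠ a in 𝓝[<] T, a ∈ Ioo t₁ T := Ioo_mem_nhdsLT ht₁T
  obtain ⟨a, hxa, hret, ⟨h1a, haT⟩, hsm1, hsm2, hsm3⟩ := (hc.and_eventually
    ((h.eventually_return_estimate hμ hT hc).and (hev.and
    ((eventually_mul_sub_lt K one_pos).and ((eventually_mul_sub_lt 1 one_pos).and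
    (eventually_mul_sub_lt (324 * B) (by linarith : 0 < 2 * c))))))).exists
  have ha0 : 0 ≤ a := by linarith
  have haD := mem_of_Ico ha0 haT
  have hsa : s < a := hst₁.trans h1a
  set g := -m.modForce γ μ a with hg
  have hg0 : 0 < g := by have := (hs a hsa haT).1; linarith
  have hgB : g ≤ B := by
    have := (abs_le.1 (abs_modForce_le hγ hμ.le (hM a haD))).1
    linarith
  have hW := h.adiabatic_estimate hμ hs0 hs hC hst₁ h1a.le haT
  rw [← hc₀, hxa, ← hg] at hW
  have hu2 : 2 * c * g ≤ m.u a ^ 2 := by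
    have h2 : (m.u a ^ 2 + 0 ^ 2) / (2 * g) + 0 = m.u a ^ 2 / (2 * g) := by ring
    rw [h2] at hW
    have h3 : c₀ ≤ Real.exp (C * T) * (m.u a ^ 2 / (2 * g)) :=
      hW.trans (mul_le_mul_of_nonneg_right (Real.exp_le_exp.2
        (mul_le_mul_of_nonneg_left haT.le hC0)) (by positivity))
    have h4 : c ≤ m.u a ^ 2 / (2 * g) := by
      rw [hcdef, div_le_iff₀ (Real.exp_pos _)]
      linarith
    rw [le_div_iff₀ (by positivity)] at h4
    linarith
  have hu0 := h.u_nonneg_of_contact haD hxa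
  rcases h.right_dichotomy haD with hfl | ⟨-, hu, -⟩
  -- By Grönwall `g` grows by at most `e < 3` before `T`, so `G = 3 g` is admissible. The resulting
  -- factor `18` squares to the `324` above.
  · obtain ⟨-, hu⟩ := hret hxa hfl (3 * g) (by positivity) fun t ht => by
      have h1 := h.modForce_growth (K := K) ha0 ht.1 ht.2 fun r hr =>
        (hs r (lt_of_lt_of_le hsa hr.1) (hr.2.trans ht.2)).2
      have h2 : Real.exp (K * (t - a)) ≤ 3 := by
        refine le_trans (Real.exp_le_exp.2 (?_ : K * (t - a) ≤ 1)) Real.exp_one_lt_three.le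
        exact le_trans (mul_le_mul_of_nonneg_left (by linarith [ht.2]) hK) hsm1.le
      have h3 := mul_le_mul_of_nonneg_right h2 hg0.le
      linarith
    have hd : 0 < T - a := sub_pos.2 haT
    have h1 : m.u a ^ 2 ≤ (18 * g * (T - a)) ^ 2 :=
      pow_le_pow_left₀ hu0 (by linarith) 2
    have h2 : 2 * c * g ≤ 324 * g * (T - a) ^ 2 * g := by nlinarith
    have h3 : 2 * c ≤ 324 * g * (T - a) ^ 2 := le_of_mul_le_mul_right h2 hg0
    have h4 : g * (T - a) ^ 2 ≤ B * (T - a) := by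
      have : (T - a) ^ 2 ≤ T - a := by nlinarith
      exact mul_le_mul hgB this (by positivity) (by linarith)
    linarith
  · rw [hu] at hu2
    have : 0 < 2 * c * g := by positivity
    linarith

/-- When contacts accumulate at `T`, the height of the lower mass is quadratically small. -/
theorem exists_quadratic_bound (hγ : 0 < γ) (hμ : 0 < μ) (hT : 0 < T) (h : m.IsSolution γ μ T)
    (hc : ∃ᶠ a in 𝓝[<] T, m.x a = 0) :
    ∃ C > 0, ∀ᶠ t in 𝓝[<] T, m.x t ≤ C * (T - t) ^ 2 := by
  obtain ⟨M, hM0, hM⟩ := h.exists_bound hγ hμ.le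
  set A := γ + 1 / 2 + M + 2 * μ * M with hA
  set B := γ + 1 / 2 + M + μ * M + μ ^ 2 * M with hB
  have hA0 : 0 < A := by positivity
  have hB0 : 0 < B := by positivity
  obtain ⟨s, hs0, hsT, hs⟩ := exists_Ioo_of_eventually_left hT
    (h.eventually_return_estimate hμ hT hc)
  have hev : ∀ t, t < T → ∃ a, t < a ∧ a < T ∧ m.x a = 0 := fun t ht => by
    have hev : ∀ᶠ a in 𝓝[<] T, a ∈ Ioo t T := Ioo_mem_nhdsLT ht
    obtain ⟨a, h1, h2⟩ := (hc.and_eventually hev).exists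
    exact ⟨a, h2.1, h2.2, h1⟩
  -- A later contact `a` has velocity at most `6 B (T - a)`, and the speed varies by at most `A (a -
  -- t)` in between. Integrating `u` up to `a`, where `x = 0`, then gives the quadratic bound.
  have hu : ∀ t, s < t → t < T → |m.u t| ≤ (6 * B + A) * (T - t) := by
    intro t hst htT
    obtain ⟨a, hta, haT, hxa⟩ := hev t htT
    have haD := mem_of_Ico (by linarith : 0 ≤ a) haT
    have hua : |m.u a| ≤ 6 * B * (T - a) := by
      rcases h.right_dichotomy haD with hfl | ⟨-, hu, -⟩
      · rw [abs_of_nonneg (h.u_nonneg_of_contact haD hxa)]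
        refine (hs a (hst.trans hta) haT hxa hfl B hB0.le fun r hr => ?_).2
        exact (abs_le.1 (abs_modForce_le hγ hμ.le (hM r (mem_of_Ico (by linarith [hr.1])
          hr.2)))).1
      · rw [hu, abs_zero]
        exact mul_nonneg (by positivity) (by linarith)
    have := h.abs_abs_u_sub_le (K := A) (by linarith) hta.le haD fun r hr =>
      abs_lowerAcc_le hγ hμ.le (hM r (mem_of_Ico (by linarith [hr.1]) (hr.2.trans haT)))
    have h2 := (abs_le.1 this).1
    nlinarith
  refine ⟨6 * B + A, by positivity, eventually_left_of_forall hsT fun t hst htT => ?_⟩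
  obtain ⟨a, hta, haT, hxa⟩ := hev t htT
  have hD : Icc t a ⊆ timeDomain (T : EReal) := fun r hr =>
    mem_of_Ico (by linarith [hr.1]) (by linarith [hr.2])
  have h1 := abs_sub_le_of_right_deriv (c := (6 * B + A) * (T - t)) hta.le
    (h.x_cont.mono hD) fun r hr => ⟨_, h.x_deriv (hD (Ico_subset_Icc_self hr)),
      (hu r (by linarith [hr.1]) (by linarith [hr.2])).trans
        (mul_le_mul_of_nonneg_left (by linarith [hr.1]) (by positivity))⟩
  rw [hxa, zero_sub, abs_neg] at h1
  have h2 : (6 * B + A) * (T - t) * (a - t) ≤ (6 * B + A) * (T - t) * (T - t) :=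
    mul_le_mul_of_nonneg_left (by linarith) (mul_nonneg (by positivity) (by linarith))
  have h3 := (le_abs_self (m.x t)).trans h1
  linarith

/-- Contacts do not accumulate: near the end of a bounded interval of existence the motion is
either free flight or continuous contact. -/
theorem flight_or_stuck_near_end (hγ : 0 < γ) (hμ : 0 < μ) (hT : 0 < T)
    (h : m.IsSolution γ μ T) :
    (∀ᶠ t in 𝓝[<] T, 0 < m.x t) ∨ (∀ᶠ t in 𝓝[<] T, m.StuckAt γ μ t) := by
  refine or_iff_not_imp_left.2 fun hnf => ?_
  have hIco : ∀ t, t ∈ Ico 0 T → t ∈ timeDomain (T : EReal) := fun t ht => mem_of_Ico ht.1 ht.2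
  have hc : ∃ᶠ a in 𝓝[<] T, m.x a = 0 := by
    refine (not_eventually.1 hnf).and_eventually (eventually_Ioo_left hT) |>.mono fun t ht => ?_
    have := h.x_nonneg t (mem_of_Ico ht.2.1.le ht.2.2)
    linarith [not_lt.1 ht.1]
  obtain ⟨M, hM0, hM⟩ := h.exists_bound hγ hμ.le
  obtain ⟨xs, ys, vs, hxl, hyl, hvl⟩ := h.exists_limits hγ hμ hT
  have hxs : xs = 0 := by
    by_contra hne
    exact hc (hxl.eventually_ne hne)
  subst hxs
  obtain ⟨Q, hQ0, hQ⟩ := h.exists_quadratic_bound hγ hμ hT hc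
  have hflim : Tendsto (m.modForce γ μ) (𝓝[<] T) (𝓝 (ys / 2 + μ * vs - γ - 1 / 2)) := by
    have := ((((hyl.div_const 2).add (hvl.const_mul μ)).sub_const γ).sub_const (1 / 2)).sub
      (hxl.const_mul (μ ^ 2))
    rwa [mul_zero, sub_zero] at this
  have hwlim : Tendsto (fun t => 1 / 2 - γ + m.x t / 2 - μ * m.v t - m.y t / 2) (𝓝[<] T)
      (𝓝 (1 / 2 - γ - μ * vs - ys / 2)) := by
    have := (((hxl.div_const 2).const_add (1 / 2 - γ)).sub (hvl.const_mul μ)).sub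
      (hyl.div_const 2)
    rwa [zero_div, add_zero] at this
  have hrlim : Tendsto (m.forceRate γ μ) (𝓝[<] T)
      (𝓝 (vs / 2 + μ * (1 / 2 - γ - μ * vs - ys / 2))) :=
    (hvl.div_const 2).add (hwlim.const_mul μ)
  have hfd : ∀ t ∈ Ico 0 T, HasDerivWithinAt (m.modForce γ μ) (m.forceRate γ μ t) (Ici t) t :=
    fun t ht => h.modForce_deriv (hIco t ht)
  have hfc : ContinuousOn (m.modForce γ μ) (Ico 0 T) := h.modForce_continuousOn.mono hIco
  set fs := ys / 2 + μ * vs - γ - 1 / 2 with hfs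
  rcases lt_trichotomy fs 0 with hneg | hzero | hpos
  · set H := M + μ * (1 / 2 + γ + M + μ * M) with hH
    have hH0 : 0 < H := by positivity
    refine h.eventually_stuck_of_modForce_neg (K := 2 * H / -fs) hγ hμ hT hc
      (div_nonneg (by positivity) (by linarith)) ?_
    filter_upwards [hflim.eventually (gt_mem_nhds (by linarith : fs < fs / 2)),
      eventually_Ioo_left hT] with t h1 h2
    refine ⟨by linarith, ?_⟩
    have h3 := (abs_le.1 (abs_forceRate_le hγ hμ.le (hM t (mem_of_Ico h2.1.le h2.2)))).1
    have h4 : 2 * H / -fs * (-fs / 2) ≤ 2 * H / -fs * -m.modForce γ μ t :=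
      mul_le_mul_of_nonneg_left (by linarith) (div_nonneg (by positivity) (by linarith))
    have h5 : 2 * H / -fs * (-fs / 2) = H := by
      have : fs ≠ 0 := hneg.ne
      field_simp
    linarith
  · rw [hzero] at hflim
    set hs := vs / 2 + μ * (1 / 2 - γ - μ * vs - ys / 2) with hhs
    rcases lt_trichotomy hs 0 with hneg | hzero' | hpos
    · exfalso
      refine h.not_eventually_modForce_pos hμ hT hc ?_
      have := eventually_ge_of_right_deriv_le (c := -hs / 2) hT hfc hfd hflim
        ((hrlim.eventually (gt_mem_nhds (by linarith : hs < hs / 2))).mono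
          fun t ht => by linarith)
      filter_upwards [this, eventually_Ioo_left hT] with t h1 h2
      exact lt_of_lt_of_le (mul_pos (by linarith) (by linarith)) h1
    · rw [hzero'] at hrlim
      have hkl : Tendsto (m.forceRateRate γ μ) (𝓝[<] T) (𝓝 (-γ)) := by
        have := (hwlim.const_mul (1 / 2 - μ ^ 2)).sub ((hvl.const_mul μ).div_const 2)
        -- Vanishing force fixes the acceleration of the upper mass at `-2 γ`, and vanishing rate
        -- fixes `vs = 4 μ γ`; all dependence on `μ` then cancels.
        have e : (1 / 2 - μ ^ 2) * (1 / 2 - γ - μ * vs - ys / 2) - μ * vs / 2 = -γ := by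
          have e1 : 1 / 2 - γ - μ * vs - ys / 2 = -2 * γ := by linarith
          have e2 : vs = 4 * μ * γ := by rw [e1] at hhs; linarith
          rw [e1, e2]; ring
        rwa [e] at this
      have htl : Tendsto (m.modForceRate γ μ) (𝓝[<] T) (𝓝 0) := by
        have := hrlim.sub (hxl.const_mul (μ - μ ^ 3))
        rwa [mul_zero, sub_zero] at this
      have hge := eventually_ge_of_right_deriv_le (c := γ / 2) hT
        (h.modForceRate_continuousOn.mono hIco) (fun t ht => h.modForceRate_deriv (hIco t ht)) htl
        ((hkl.eventually (gt_mem_nhds (by linarith : -γ < -(γ / 2)))).mono fun t ht => ht.le)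
      -- The correction `(μ - μ³) x` is quadratically small in `T - t`, hence negligible against the
      -- linear lower bound for `modForceRate`; half of that bound survives.
      have hrate : ∀ᶠ t in 𝓝[<] T, γ / 4 * (T - t) ≤ m.forceRate γ μ t := by
        filter_upwards [hge, hQ, eventually_Ioo_left hT,
          eventually_mul_sub_lt (|μ - μ ^ 3| * Q) (by linarith : 0 < γ / 4)] with t h1 h2 h3 h4
        have hx0 := h.x_nonneg t (mem_of_Ico h3.1.le h3.2)
        have e1 : -(|μ - μ ^ 3| * m.x t) ≤ (μ - μ ^ 3) * m.x t := by
          have := mul_le_mul_of_nonneg_right (neg_abs_le (μ - μ ^ 3)) hx0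
          linarith
        have e2 := mul_le_mul_of_nonneg_left h2 (abs_nonneg (μ - μ ^ 3))
        have e3 := mul_le_mul_of_nonneg_right h4.le (by linarith : 0 ≤ T - t)
        rw [Motion.modForceRate] at h1
        linarith
      obtain ⟨s, hs0, hsT, hrate'⟩ := exists_Ioo_of_eventually_left hT hrate
      have hle := eventually_le_of_le_right_deriv (c := 0) hT hfc hfd hflim (by
        filter_upwards [hrate, eventually_Ioo_left hT] with t h1 h2
        exact le_trans (mul_nonneg (by linarith) (by linarith)) h1)
      obtain ⟨s', hs'0, hs'T, hle'⟩ := exists_Ioo_of_eventually_left hsT hle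
      refine h.eventually_stuck_of_modForce_neg (K := 0) hγ hμ hT hc le_rfl
        (eventually_left_of_forall hs'T fun t hst htT => ?_)
      have h0 : 0 < γ / 4 * (T - t) := mul_pos (by linarith) (by linarith)
      refine ⟨?_, by linarith [hrate' t (by linarith) htT]⟩
      -- Strict negativity: the force is at most `0` at the midpoint between `t` and `T` and
      -- increases strictly on the way there.
      have h1 := le_sub_of_le_right_deriv (f := m.modForce γ μ) (a := t) (b := (t + T) / 2)
        (c := γ / 4 * (T - (t + T) / 2)) (by linarith)
        (hfc.mono fun r hr => ⟨by linarith [hr.1], by linarith [hr.2]⟩) fun r hr =>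
        ⟨_, hfd r ⟨by linarith [hr.1], by linarith [hr.2]⟩,
          (mul_le_mul_of_nonneg_left (by linarith [hr.2]) (by linarith)).trans
            (hrate' r (by linarith [hr.1]) (by linarith [hr.2]))⟩
      have h2 := hle' ((t + T) / 2) (by linarith) (by linarith)
      have h3 : 0 < γ / 4 * (T - (t + T) / 2) * ((t + T) / 2 - t) :=
        mul_pos (mul_pos (by linarith) (by linarith)) (by linarith)
      linarith
    · have hev := (hrlim.eventually (lt_mem_nhds (by linarith : hs / 2 < hs))).mono
        fun t ht => ht.le
      have := eventually_le_of_le_right_deriv (c := hs / 2) hT hfc hfd hflim hev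
      refine h.eventually_stuck_of_modForce_neg (K := 0) hγ hμ hT hc le_rfl ?_
      filter_upwards [this, hev, eventually_Ioo_left hT] with t h1 h2 h3
      have : 0 < hs / 2 * (T - t) := mul_pos (by linarith) (by linarith)
      exact ⟨by linarith, by linarith⟩
  · exact absurd (hflim.eventually (lt_mem_nhds hpos)) (h.not_eventually_modForce_pos hμ hT hc)

theorem grazings_finite_of_coe (hγ : 0 < γ) (hμ : 0 < μ) (hT : 0 < T)
    (h : m.IsSolution γ μ T) : (m.grazings T).Finite := by
  suffices hb : ∃ S, 0 ≤ S ∧ S < T ∧ ∀ t, S < t → t < T → t ∉ m.grazings T by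
    obtain ⟨S, h0, hS, hn⟩ := hb
    refine h.grazings_finite_of_bounded (mem_of_Ico h0 hS) fun t ht => ?_
    by_contra hlt
    exact hn t (not_le.1 hlt) (mem_timeDomain_coe.1 ht.1).2 ht
  rcases h.flight_or_stuck_near_end hγ hμ hT with h1 | h1
  · obtain ⟨S, h0, hS, hn⟩ := exists_Ioo_of_eventually_left hT h1
    exact ⟨S, h0, hS, fun t h1 h2 hg => (hn t h1 h2).ne' hg.2.1⟩
  · obtain ⟨S, h0, hS, hn⟩ := exists_Ioo_of_eventually_left hT h1
    refine ⟨S, h0, hS, fun t h1 h2 => notMem_grazings_of_stuck (γ := γ) (μ := μ)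
      (mem_of_Ico (by linarith) h2) (by linarith) ?_⟩
    filter_upwards [Ioo_mem_nhds h1 h2] with r hr using hn r hr.1 hr.2

end Motion.IsSolution

/-! ### Local existence -/

theorem eventually_pos_of_hasDerivAt {f : ℝ → ℝ} {T e : ℝ} (hd : HasDerivAt f e T)
    (h0 : f T = 0) (he : 0 < e) : ∀ᶠ t in 𝓝[>] T, 0 < f t := by
  have h1 : Tendsto (slope f T) (𝓝[>] T) (𝓝 e) :=
    (hasDerivWithinAt_iff_tendsto_slope' self_notMem_Ioi).1 hd.hasDerivWithinAt
  filter_upwards [h1.eventually (lt_mem_nhds he), self_mem_nhdsWithin] with t ht htT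
  rw [slope_def_field, h0, sub_zero] at ht
  exact (div_pos_iff_of_pos_right (sub_pos.2 htT)).1 ht

theorem eventually_pos_of_deriv_pos {f f' : ℝ → ℝ} {T : ℝ}
    (hd : ∀ᶠ t in 𝓝 T, HasDerivAt f (f' t) t) (h0 : f T = 0)
    (he : ∀ᶠ t in 𝓝[>] T, 0 < f' t) : ∀ᶠ t in 𝓝[>] T, 0 < f t := by
  obtain ⟨b, hb, hsub⟩ := mem_nhdsGT_iff_exists_Ioo_subset.1
    (inter_mem he (nhdsWithin_le_nhds hd : {t | HasDerivAt f (f' t) t} ∈ 𝓝[>] T))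
  filter_upwards [Ioo_mem_nhdsGT hb] with t ht
  obtain ⟨c, hc, hcd⟩ := exists_hasDerivAt_eq_slope f f' ht.1
    (fun r hr => by
      rcases hr.1.eq_or_lt with rfl | hlt
      · exact hd.self_of_nhds.continuousAt.continuousWithinAt
      · exact (hsub ⟨hlt, lt_of_le_of_lt hr.2 ht.2⟩).2.continuousAt.continuousWithinAt)
    fun r hr => (hsub ⟨hr.1, hr.2.trans ht.2⟩).2
  have hpos : 0 < f' c := (hsub ⟨hc.1, hc.2.trans ht.2⟩).1
  rw [hcd, h0, sub_zero] at hpos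
  exact (div_pos_iff_of_pos_right (sub_pos.2 ht.1)).1 hpos

theorem exists_free_motion (γ μ T x₀ u₀ y₀ v₀ : ℝ) :
    ∃ m : Motion, m.x T = x₀ ∧ m.u T = u₀ ∧ m.y T = y₀ ∧ m.v T = v₀ ∧
      ∀ᶠ t in 𝓝 T, m.FreeAt γ μ t := by
  let f : ℝ × ℝ × ℝ × ℝ → ℝ × ℝ × ℝ × ℝ := fun z =>
    (z.2.1, -γ - 1 / 2 + z.2.2.1 / 2 + μ * z.2.2.2 - μ * z.2.1 - z.1 / 2, z.2.2.2,
      -γ + 1 / 2 + z.1 / 2 + μ * z.2.1 - μ * z.2.2.2 - z.2.2.1 / 2)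
  have hf : ContDiff ℝ 1 f := by
    simp only [f]
    fun_prop
  obtain ⟨α, hα0, ε, hε, hα⟩ :=
    (hf.contDiffAt (x := (x₀, u₀, y₀, v₀))).exists_forall_mem_closedBall_exists_eq_forall_mem_Ioo_hasDerivAt₀
      T
  refine ⟨⟨fun t => (α t).1, fun t => (α t).2.1, fun t => (α t).2.2.1, fun t => (α t).2.2.2⟩,
    by simp [hα0], by simp [hα0], by simp [hα0], by simp [hα0], ?_⟩
  filter_upwards [Ioo_mem_nhds (sub_lt_self T hε) (lt_add_of_pos_right T hε)] with t ht
  have h := hα t ht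
  have h1 := h.snd
  have h2 := h1.snd
  exact ⟨h.fst, h1.fst, h2.fst, h2.snd⟩

theorem exists_rest_motion (γ μ T y₀ v₀ : ℝ) :
    ∃ m : Motion, (∀ t, m.x t = 0 ∧ m.u t = 0) ∧ m.y T = y₀ ∧ m.v T = v₀ ∧
      ∀ᶠ t in 𝓝 T, HasDerivAt m.y (m.v t) t ∧
        HasDerivAt m.v (-γ + 1 / 2 - μ * m.v t - m.y t / 2) t := by
  let f : ℝ × ℝ → ℝ × ℝ := fun z => (z.2, -γ + 1 / 2 - μ * z.2 - z.1 / 2)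
  have hf : ContDiff ℝ 1 f := by
    simp only [f]
    fun_prop
  obtain ⟨α, hα0, ε, hε, hα⟩ :=
    (hf.contDiffAt (x := (y₀, v₀))).exists_forall_mem_closedBall_exists_eq_forall_mem_Ioo_hasDerivAt₀
      T
  refine ⟨⟨fun _ => 0, fun _ => 0, fun t => (α t).1, fun t => (α t).2⟩,
    fun t => ⟨rfl, rfl⟩, by simp [hα0], by simp [hα0], ?_⟩
  filter_upwards [Ioo_mem_nhds (sub_lt_self T hε) (lt_add_of_pos_right T hε)] with t ht
  exact ⟨(hα t ht).fst, (hα t ht).snd⟩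

/-- A motion that starts at time `T` from the given state, and flies or rests on the floor for a
short time after `T`. -/
structure Motion.StartsAt (γ μ T x₀ u₀ y₀ v₀ : ℝ) (m : Motion) : Prop where
  x_eq : m.x T = x₀
  u_eq : m.u T = u₀
  y_eq : m.y T = y₀
  v_eq : m.v T = v₀
  x_cont : ContinuousAt m.x T
  u_cont : ContinuousAt m.u T
  y_cont : ContinuousAt m.y T
  v_cont : ContinuousAt m.v T
  after : (∀ᶠ t in 𝓝[>] T, m.FreeAt γ μ t ∧ 0 < m.x t) ∨ (∀ᶠ t in 𝓝[>] T, m.StuckAt γ μ t)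

theorem exists_startsAt_of_takeoff {γ μ T x₀ u₀ y₀ v₀ : ℝ}
    (hx : ∀ m : Motion, m.x T = x₀ → m.u T = u₀ → m.y T = y₀ → m.v T = v₀ →
      (∀ᶠ t in 𝓝 T, m.FreeAt γ μ t) → ∀ᶠ t in 𝓝[>] T, 0 < m.x t) :
    ∃ m : Motion, m.StartsAt γ μ T x₀ u₀ y₀ v₀ := by
  obtain ⟨m, h1, h2, h3, h4, hf⟩ := exists_free_motion γ μ T x₀ u₀ y₀ v₀
  have h0 := hf.self_of_nhds
  exact ⟨m, h1, h2, h3, h4, h0.deriv_x.continuousAt, h0.deriv_u.continuousAt,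
    h0.deriv_y.continuousAt, h0.deriv_v.continuousAt,
    Or.inl ((hf.filter_mono nhdsWithin_le_nhds).and (hx m h1 h2 h3 h4 hf))⟩

theorem exists_startsAt_of_rest {γ μ T y₀ v₀ : ℝ}
    (hF : ∀ m : Motion, m.y T = y₀ → m.v T = v₀ →
      (∀ᶠ t in 𝓝 T, HasDerivAt m.y (m.v t) t ∧
        HasDerivAt m.v (-γ + 1 / 2 - μ * m.v t - m.y t / 2) t) →
      ∀ᶠ t in 𝓝[>] T, m.floorForce γ μ t ≤ 0) :
    ∃ m : Motion, m.StartsAt γ μ T 0 0 y₀ v₀ := by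
  obtain ⟨m, h1, h3, h4, hf⟩ := exists_rest_motion γ μ T y₀ v₀
  have h0 := hf.self_of_nhds
  have hx : m.x = fun _ => 0 := funext fun t => (h1 t).1
  have hu : m.u = fun _ => 0 := funext fun t => (h1 t).2
  refine ⟨m, (h1 T).1, (h1 T).2, h3, h4, hx ▸ continuousAt_const, hu ▸ continuousAt_const,
    h0.1.continuousAt, h0.2.continuousAt, Or.inr ?_⟩
  filter_upwards [hF m h3 h4 hf, nhdsWithin_le_nhds hf] with t ht1 ht2
  exact ⟨(h1 t).1, (h1 t).2, ht2.1, ht2.2, ht1⟩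

/-- Only `x₀ = u₀ = 0` is delicate. The sign of the force decides; if it is zero, its derivative `v₀
/ 2 - 2 μ γ` does; if that is zero too, the second derivative at rest equals `-γ < 0`, so the mass
stays on the floor. -/
theorem exists_startsAt {γ μ T x₀ u₀ y₀ v₀ : ℝ} (hγ : 0 < γ) (hx₀ : 0 ≤ x₀)
    (hu₀ : x₀ = 0 → 0 ≤ u₀) : ∃ m : Motion, m.StartsAt γ μ T x₀ u₀ y₀ v₀ := by
  rcases hx₀.lt_or_eq with hx | rfl
  · refine exists_startsAt_of_takeoff fun m h1 h2 h3 h4 hf => ?_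
    exact nhdsWithin_le_nhds (hf.self_of_nhds.deriv_x.continuousAt.eventually
      (lt_mem_nhds (by rwa [h1])))
  rcases (hu₀ rfl).lt_or_eq with hu | rfl
  · exact exists_startsAt_of_takeoff fun m h1 h2 h3 h4 hf =>
      eventually_pos_of_hasDerivAt hf.self_of_nhds.deriv_x h1 (by rwa [h2])
  have hfly : ∀ m : Motion, m.x T = 0 → m.u T = 0 →
      (∀ᶠ t in 𝓝 T, m.FreeAt γ μ t) → (∀ᶠ t in 𝓝[>] T, 0 < m.lowerAcc γ μ t) →
      ∀ᶠ t in 𝓝[>] T, 0 < m.x t := fun m h1 h2 hf hR =>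
    eventually_pos_of_deriv_pos (hf.mono fun t ht => ht.deriv_x) h1
      (eventually_pos_of_deriv_pos (hf.mono fun t ht => ht.deriv_u) h2 hR)
  rcases lt_trichotomy (y₀ / 2 + μ * v₀ - γ - 1 / 2) 0 with hF | hF | hF
  · refine exists_startsAt_of_rest fun m h3 h4 hf => ?_
    have hy := hf.self_of_nhds.1.continuousAt
    have hv := hf.self_of_nhds.2.continuousAt
    have hc : ContinuousAt (m.floorForce γ μ) T := by
      unfold Motion.floorForce
      fun_prop
    have h0 : m.floorForce γ μ T < 0 := by rwa [Motion.floorForce, h3, h4]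
    exact ((hc.eventually (gt_mem_nhds h0)).mono fun t ht => le_of_lt ht).filter_mono
      nhdsWithin_le_nhds
  · rcases le_or_gt (v₀ / 2 - 2 * μ * γ) 0 with hG | hG
    · refine exists_startsAt_of_rest fun m h3 h4 hf => ?_
      have hd : ∀ᶠ t in 𝓝 T, HasDerivAt (fun t => -m.floorForce γ μ t)
          (-(m.v t / 2 + μ * (-γ + 1 / 2 - μ * m.v t - m.y t / 2))) t := by
        filter_upwards [hf] with t ht
        exact ((((ht.1.div_const 2).add (ht.2.const_mul μ)).sub_const γ).sub_const (1 / 2)).neg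
      have hF0 : -m.floorForce γ μ T = 0 := by
        rw [Motion.floorForce, h3, h4, hF, neg_zero]
      have hv' : -γ + 1 / 2 - μ * v₀ - y₀ / 2 = -2 * γ := by linarith
      suffices hpos : ∀ᶠ t in 𝓝[>] T, 0 < -m.floorForce γ μ t from
        hpos.mono fun t ht => by linarith
      rcases hG.lt_or_eq with hG | hG
      · refine eventually_pos_of_hasDerivAt hd.self_of_nhds hF0 ?_
        rw [h3, h4, hv']
        linarith
      · refine eventually_pos_of_deriv_pos hd hF0 ?_
        obtain ⟨hy, hv⟩ := hf.self_of_nhds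
        refine eventually_pos_of_hasDerivAt ((hv.div_const 2).add ((((hv.const_mul μ).const_sub
          (-γ + 1 / 2)).sub (hy.div_const 2)).const_mul μ)).neg ?_ ?_
        · rw [neg_eq_zero]
          change m.v T / 2 + μ * (-γ + 1 / 2 - μ * m.v T - m.y T / 2) = 0
          rw [h3, h4, hv']
          linarith
        · rw [h3, h4, hv']
          have : v₀ = 4 * μ * γ := by linarith
          rw [this]
          nlinarith
    · refine exists_startsAt_of_takeoff fun m h1 h2 h3 h4 hf => hfly m h1 h2 hf ?_
      have h0 := hf.self_of_nhds
      refine eventually_pos_of_hasDerivAt (((((h0.deriv_y.div_const 2).const_add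
        (-γ - 1 / 2)).add (h0.deriv_v.const_mul μ)).sub (h0.deriv_u.const_mul μ)).sub
        (h0.deriv_x.div_const 2)) ?_ ?_
      · rw [Motion.lowerAcc, h1, h2, h3, h4]
        linarith
      · rw [h1, h2, h3, h4]
        have hv' : -γ + 1 / 2 + 0 / 2 + μ * 0 - μ * v₀ - y₀ / 2 = -2 * γ := by linarith
        have hu' : -γ - 1 / 2 + y₀ / 2 + μ * v₀ - μ * 0 - 0 / 2 = 0 := by linarith
        rw [hv', hu']
        linarith
  · refine exists_startsAt_of_takeoff fun m h1 h2 h3 h4 hf => hfly m h1 h2 hf ?_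
    have h0 := hf.self_of_nhds
    have h5 := h0.deriv_x.continuousAt
    have h6 := h0.deriv_u.continuousAt
    have h7 := h0.deriv_y.continuousAt
    have h8 := h0.deriv_v.continuousAt
    have hc : ContinuousAt (m.lowerAcc γ μ) T := by
      unfold Motion.lowerAcc
      fun_prop
    refine nhdsWithin_le_nhds (hc.eventually (lt_mem_nhds ?_))
    rw [Motion.lowerAcc, h1, h2, h3, h4]
    linarith

/-! ### Solutions as a local notion -/

/-- Two motions are in the same state at time `t`. -/
def Motion.Agree (m m' : Motion) (t : ℝ) : Prop :=
  m.x t = m'.x t ∧ m.u t = m'.u t ∧ m.y t = m'.y t ∧ m.v t = m'.v t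

/-- The requirements of `Motion.IsSolution` at a single time. -/
structure Motion.SolvesAt (γ μ : ℝ) (m : Motion) (t : ℝ) : Prop where
  x_nonneg : 0 ≤ m.x t
  x_cont : ContinuousWithinAt m.x (Ici 0) t
  y_cont : ContinuousWithinAt m.y (Ici 0) t
  v_cont : ContinuousWithinAt m.v (Ici 0) t
  u_right_cont : ContinuousWithinAt m.u (Ici t) t
  impact : 0 < t → m.x t = 0 → Tendsto m.u (𝓝[<] t) (𝓝 (-m.u t))
  flight : 0 < t → 0 < m.x t → m.FreeAt γ μ t
  after_contact : m.x t = 0 →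
    (∀ᶠ s in 𝓝[>] t, 0 < m.x s) ∨ (∀ᶠ s in 𝓝[>] t, m.StuckAt γ μ s)
  before_contact : 0 < t → m.x t = 0 →
    (∀ᶠ s in 𝓝[<] t, 0 < m.x s) ∨ (∀ᶠ s in 𝓝[<] t, m.StuckAt γ μ s)

theorem timeDomain_mem_nhdsWithin_Ici {T : EReal} {t : ℝ} (ht : t ∈ timeDomain T) :
    timeDomain T ∈ 𝓝[Ici 0] t := by
  filter_upwards [nhdsWithin_le_nhds (eventually_coe_lt ht), self_mem_nhdsWithin] with s h1 h2
  exact ⟨h2, h1⟩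

theorem Motion.isSolution_iff {γ μ : ℝ} {T : EReal} {m : Motion} :
    m.IsSolution γ μ T ↔ ∀ t ∈ timeDomain T, m.SolvesAt γ μ t := by
  have hsub : timeDomain T ⊆ Ici 0 := fun t ht => ht.1
  constructor
  · intro h t ht
    exact ⟨h.x_nonneg t ht,
      (h.x_cont t ht).mono_of_mem_nhdsWithin (timeDomain_mem_nhdsWithin_Ici ht),
      (h.y_cont t ht).mono_of_mem_nhdsWithin (timeDomain_mem_nhdsWithin_Ici ht),
      (h.v_cont t ht).mono_of_mem_nhdsWithin (timeDomain_mem_nhdsWithin_Ici ht),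
      h.u_right_cont t ht, h.impact t ht, h.flight t ht, h.after_contact t ht,
      h.before_contact t ht⟩
  · intro h
    exact ⟨fun t ht => (h t ht).x_nonneg, fun t ht => (h t ht).x_cont.mono hsub,
      fun t ht => (h t ht).y_cont.mono hsub, fun t ht => (h t ht).v_cont.mono hsub,
      fun t ht => (h t ht).u_right_cont, fun t ht => (h t ht).impact,
      fun t ht => (h t ht).flight, fun t ht => (h t ht).after_contact,
      fun t ht => (h t ht).before_contact⟩

/-! ### Invariance under agreement near an instant -/

section Congr

variable {γ μ : ℝ} {m m' : Motion} {t : ℝ}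

theorem Motion.FreeAt.congr (h : m.FreeAt γ μ t) (he : ∀ᶠ s in 𝓝 t, m.Agree m' s) :
    m'.FreeAt γ μ t := by
  obtain ⟨e1, e2, e3, e4⟩ := he.self_of_nhds
  obtain ⟨h1, h2, h3, h4⟩ := h
  rw [e1, e2, e3, e4] at h2 h4
  rw [e2] at h1
  rw [e4] at h3
  exact ⟨h1.congr_of_eventuallyEq (he.mono fun s hs => hs.1.symm),
    h2.congr_of_eventuallyEq (he.mono fun s hs => hs.2.1.symm),
    h3.congr_of_eventuallyEq (he.mono fun s hs => hs.2.2.1.symm),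
    h4.congr_of_eventuallyEq (he.mono fun s hs => hs.2.2.2.symm)⟩

theorem Motion.StuckAt.congr (h : m.StuckAt γ μ t) (he : ∀ᶠ s in 𝓝 t, m.Agree m' s) :
    m'.StuckAt γ μ t := by
  obtain ⟨e1, e2, e3, e4⟩ := he.self_of_nhds
  obtain ⟨h1, h2, h3, h4, h5⟩ := h
  rw [e1] at h1
  rw [e2] at h2
  rw [e4] at h3
  rw [e3, e4] at h4
  rw [Motion.floorForce, e3, e4] at h5
  exact ⟨h1, h2, h3.congr_of_eventuallyEq (he.mono fun s hs => hs.2.2.1.symm),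
    h4.congr_of_eventuallyEq (he.mono fun s hs => hs.2.2.2.symm), h5⟩

theorem Motion.eventually_dichotomy_congr {l : Filter ℝ} (hl : l ≤ 𝓝 t)
    (he : ∀ᶠ s in 𝓝 t, m.Agree m' s)
    (h : (∀ᶠ s in l, 0 < m.x s) ∨ (∀ᶠ s in l, m.StuckAt γ μ s)) :
    (∀ᶠ s in l, 0 < m'.x s) ∨ (∀ᶠ s in l, m'.StuckAt γ μ s) := by
  rcases h with h | h
  · left
    filter_upwards [h, hl he] with s h1 h2
    rwa [← h2.1]
  · right
    filter_upwards [h, hl (eventually_eventually_nhds.2 he)] with s h1 h2 using h1.congr h2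

theorem Motion.SolvesAt.congr (h : m.SolvesAt γ μ t) (he : ∀ᶠ s in 𝓝 t, m.Agree m' s) :
    m'.SolvesAt γ μ t := by
  obtain ⟨e1, e2, e3, e4⟩ := he.self_of_nhds
  have ex : m'.x =ᶠ[𝓝 t] m.x := he.mono fun s hs => hs.1.symm
  have eu : m'.u =ᶠ[𝓝 t] m.u := he.mono fun s hs => hs.2.1.symm
  have ey : m'.y =ᶠ[𝓝 t] m.y := he.mono fun s hs => hs.2.2.1.symm
  have ev : m'.v =ᶠ[𝓝 t] m.v := he.mono fun s hs => hs.2.2.2.symm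
  refine ⟨e1 ▸ h.x_nonneg,
    h.x_cont.congr_of_eventuallyEq (ex.filter_mono nhdsWithin_le_nhds) e1.symm,
    h.y_cont.congr_of_eventuallyEq (ey.filter_mono nhdsWithin_le_nhds) e3.symm,
    h.v_cont.congr_of_eventuallyEq (ev.filter_mono nhdsWithin_le_nhds) e4.symm,
    h.u_right_cont.congr_of_eventuallyEq (eu.filter_mono nhdsWithin_le_nhds) e2.symm,
    fun h0 hx => ?_, fun h0 hx => (h.flight h0 (e1 ▸ hx)).congr he,
    fun hx => eventually_dichotomy_congr nhdsWithin_le_nhds he (h.after_contact (e1 ▸ hx)),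
    fun h0 hx => eventually_dichotomy_congr nhdsWithin_le_nhds he
      (h.before_contact h0 (e1 ▸ hx))⟩
  rw [← e2]
  exact (h.impact h0 (e1 ▸ hx)).congr' (eu.filter_mono nhdsWithin_le_nhds).symm

end Congr

theorem Motion.SolvesAt.of_flight {γ μ : ℝ} {m : Motion} {t : ℝ} (hf : m.FreeAt γ μ t)
    (hx : 0 < m.x t) : m.SolvesAt γ μ t :=
  ⟨hx.le, hf.deriv_x.continuousAt.continuousWithinAt, hf.deriv_y.continuousAt.continuousWithinAt,
    hf.deriv_v.continuousAt.continuousWithinAt, hf.deriv_u.continuousAt.continuousWithinAt,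
    fun _ h => absurd h hx.ne', fun _ _ => hf, fun h => absurd h hx.ne',
    fun _ h => absurd h hx.ne'⟩

theorem Motion.SolvesAt.of_stuck {γ μ : ℝ} {m : Motion} {t : ℝ}
    (hs : ∀ᶠ s in 𝓝 t, m.StuckAt γ μ s) : m.SolvesAt γ μ t := by
  have h0 := hs.self_of_nhds
  have hx : ContinuousAt m.x t := continuousAt_const (y := (0 : ℝ)) |>.congr
    (hs.mono fun s h => h.x_eq.symm)
  have hu : ContinuousAt m.u t := continuousAt_const (y := (0 : ℝ)) |>.congr
    (hs.mono fun s h => h.u_eq.symm)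
  refine ⟨h0.x_eq.ge, hx.continuousWithinAt, h0.deriv_y.continuousAt.continuousWithinAt,
    h0.deriv_v.continuousAt.continuousWithinAt, hu.continuousWithinAt, fun _ _ => ?_,
    fun _ h => absurd h0.x_eq h.ne', fun _ => Or.inr (hs.filter_mono nhdsWithin_le_nhds),
    fun _ _ => Or.inr (hs.filter_mono nhdsWithin_le_nhds)⟩
  have := hu.tendsto.mono_left (nhdsWithin_le_nhds (s := Iio t))
  rwa [h0.u_eq, ← neg_zero, ← h0.u_eq] at this

/-! ### Extension of solutions -/

/-- The motion that follows `m` before time `T` and `w` from then on. -/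
noncomputable def Motion.glue (T : ℝ) (m w : Motion) : Motion where
  x t := if t < T then m.x t else w.x t
  u t := if t < T then m.u t else w.u t
  y t := if t < T then m.y t else w.y t
  v t := if t < T then m.v t else w.v t

theorem Motion.agree_glue_left {T t : ℝ} (m w : Motion) (ht : t < T) :
    m.Agree (Motion.glue T m w) t := by
  simp [Motion.Agree, Motion.glue, ht]

theorem Motion.agree_glue_right {T t : ℝ} (m w : Motion) (ht : T ≤ t) :
    w.Agree (Motion.glue T m w) t := by
  simp [Motion.Agree, Motion.glue, not_lt.2 ht]

theorem continuousWithinAt_Ici_zero_of {f : ℝ → ℝ} {T : ℝ} (hT : 0 ≤ T)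
    (hr : ContinuousWithinAt f (Ici T) T) (hl : 0 < T → Tendsto f (𝓝[<] T) (𝓝 (f T))) :
    ContinuousWithinAt f (Ici 0) T := by
  rcases hT.eq_or_lt with rfl | hT
  · exact hr
  · exact (continuousAt_iff_continuous_left'_right'.2
      ⟨hl hT, hr.mono Ioi_subset_Ici_self⟩).continuousWithinAt

/-- The junction is the only instant not covered by locality. The limits from the left must match
the new state, with `u` reversed if the junction is a contact; `hl` supplies the left half of the
no-accumulation condition. -/
theorem Motion.solvesAt_glue {γ μ T x₀ u₀ y₀ v₀ : ℝ} {m w : Motion} (hT : 0 ≤ T)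
    (hm : m.IsSolution γ μ T) (hw : w.StartsAt γ μ T x₀ u₀ y₀ v₀) (hx₀ : 0 ≤ x₀)
    (hlx : 0 < T → Tendsto m.x (𝓝[<] T) (𝓝 x₀)) (hly : 0 < T → Tendsto m.y (𝓝[<] T) (𝓝 y₀))
    (hlv : 0 < T → Tendsto m.v (𝓝[<] T) (𝓝 v₀))
    (hlu : 0 < T → 0 < x₀ → Tendsto m.u (𝓝[<] T) (𝓝 u₀))
    (hlu' : 0 < T → x₀ = 0 → Tendsto m.u (𝓝[<] T) (𝓝 (-u₀)))
    (hl : 0 < T → (∀ᶠ t in 𝓝[<] T, 0 < m.x t) ∨ (∀ᶠ t in 𝓝[<] T, m.StuckAt γ μ t)) :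
    (Motion.glue T m w).SolvesAt γ μ T := by
  set g := Motion.glue T m w with hg
  obtain ⟨ex, eu, ey, ev⟩ := Motion.agree_glue_right m w (le_refl T)
  rw [← hg, hw.x_eq] at ex
  rw [← hg, hw.u_eq] at eu
  rw [← hg, hw.y_eq] at ey
  rw [← hg, hw.v_eq] at ev
  have hL : ∀ᶠ s in 𝓝[<] T, ∀ᶠ r in 𝓝 s, m.Agree g r := by
    filter_upwards [self_mem_nhdsWithin] with s hs
    filter_upwards [gt_mem_nhds hs] with r hr using Motion.agree_glue_left m w hr
  have hR : ∀ᶠ s in 𝓝[>] T, ∀ᶠ r in 𝓝 s, w.Agree g r := by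
    filter_upwards [self_mem_nhdsWithin] with s hs
    filter_upwards [lt_mem_nhds hs] with r hr using Motion.agree_glue_right m w (le_of_lt hr)
  have hL' := hL.mono fun s hs => hs.self_of_nhds
  have hR' : ∀ s ∈ Ici T, w.Agree g s := fun s hs => Motion.agree_glue_right m w hs
  have cx : ContinuousWithinAt g.x (Ici T) T := hw.x_cont.continuousWithinAt.congr
    (fun s hs => (hR' s hs).1.symm) (hR' T self_mem_Ici).1.symm
  have cu : ContinuousWithinAt g.u (Ici T) T := hw.u_cont.continuousWithinAt.congr
    (fun s hs => (hR' s hs).2.1.symm) (hR' T self_mem_Ici).2.1.symm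
  have cy : ContinuousWithinAt g.y (Ici T) T := hw.y_cont.continuousWithinAt.congr
    (fun s hs => (hR' s hs).2.2.1.symm) (hR' T self_mem_Ici).2.2.1.symm
  have cv : ContinuousWithinAt g.v (Ici T) T := hw.v_cont.continuousWithinAt.congr
    (fun s hs => (hR' s hs).2.2.2.symm) (hR' T self_mem_Ici).2.2.2.symm
  have lx : 0 < T → Tendsto g.x (𝓝[<] T) (𝓝 (g.x T)) := fun h0 =>
    ex ▸ (hlx h0).congr' (hL'.mono fun s hs => hs.1)
  have ly : 0 < T → Tendsto g.y (𝓝[<] T) (𝓝 (g.y T)) := fun h0 =>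
    ey ▸ (hly h0).congr' (hL'.mono fun s hs => hs.2.2.1)
  have lv : 0 < T → Tendsto g.v (𝓝[<] T) (𝓝 (g.v T)) := fun h0 =>
    ev ▸ (hlv h0).congr' (hL'.mono fun s hs => hs.2.2.2)
  refine ⟨ex ▸ hx₀, continuousWithinAt_Ici_zero_of hT cx lx,
    continuousWithinAt_Ici_zero_of hT cy ly, continuousWithinAt_Ici_zero_of hT cv lv, cu,
    fun h0 hx => ?_, fun h0 hx => ?_, fun hx => ?_, fun h0 hx => ?_⟩
  · rw [← eu]
    exact (hlu' h0 (ex.trans hx)).congr' (hL'.mono fun s hs => hs.2.1)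
  · have lu : Tendsto g.u (𝓝[<] T) (𝓝 (g.u T)) :=
      eu ▸ (hlu h0 (ex ▸ hx)).congr' (hL'.mono fun s hs => hs.2.1)
    have hfl : ∀ᶠ s in 𝓝[<] T, g.FreeAt γ μ s := by
      filter_upwards [hL, (hlx h0).eventually (lt_mem_nhds (ex ▸ hx : 0 < x₀)),
        eventually_Ioo_left h0] with s h1 h2 h3
      exact (hm.flight s (IsSolution.mem_of_Ico h3.1.le h3.2) h3.1 h2).congr h1
    have hfr : ∀ᶠ s in 𝓝[>] T, g.FreeAt γ μ s := by
      rcases hw.after with h1 | h1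
      · filter_upwards [hR, h1] with s h2 h3 using h3.1.congr h2
      · exfalso
        have h2 : Tendsto w.x (𝓝[>] T) (𝓝 x₀) := by
          have := hw.x_cont.tendsto.mono_left (nhdsWithin_le_nhds (s := Ioi T))
          rwa [hw.x_eq] at this
        obtain ⟨s, h3, h4⟩ := (h1.and (h2.eventually (lt_mem_nhds (ex ▸ hx : 0 < x₀)))).exists
        rw [h3.x_eq] at h4
        exact lt_irrefl _ h4
    have hall : ∀ᶠ s in 𝓝[≠] T, g.FreeAt γ μ s := by
      rw [← Iio_union_Ioi, nhdsWithin_union, eventually_sup]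
      exact ⟨hfl, hfr⟩
    have cont : ∀ {f : ℝ → ℝ}, ContinuousWithinAt f (Ici T) T →
        Tendsto f (𝓝[<] T) (𝓝 (f T)) → ContinuousAt f T := fun hr hl =>
      continuousAt_iff_continuous_left'_right'.2 ⟨hl, hr.mono Ioi_subset_Ici_self⟩
    have kx := cont cx (lx h0)
    have ku := cont cu lu
    have ky := cont cy (ly h0)
    have kv := cont cv (lv h0)
    -- For a junction in mid-flight the equations hold on both punctured sides, and continuity of
    -- the right-hand sides carries them to `T`.
    have ext : ∀ {f f' : ℝ → ℝ}, ContinuousAt f T → ContinuousAt f' T →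
        (∀ᶠ s in 𝓝[≠] T, HasDerivAt f (f' s) s) → HasDerivAt f (f' T) T := by
      intro f f' hf hf' hd
      rw [← Iio_union_Ioi, nhdsWithin_union, eventually_sup] at hd
      exact hasDerivAt_of_left_right
        (hasDerivWithinAt_Iic_of_eventually hf.continuousWithinAt hd.1
          (hf'.tendsto.mono_left nhdsWithin_le_nhds))
        (hasDerivWithinAt_Ici_of_eventually hf.continuousWithinAt hd.2
          (hf'.tendsto.mono_left nhdsWithin_le_nhds))
    refine ⟨ext kx ku (hall.mono fun s hs => hs.deriv_x),
      ext (f' := g.lowerAcc γ μ) ku ?_ (hall.mono fun s hs => hs.deriv_u),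
      ext ky kv (hall.mono fun s hs => hs.deriv_y),
      ext (f' := g.upperAcc γ μ) kv ?_ (hall.mono fun s hs => hs.deriv_v)⟩
    · unfold Motion.lowerAcc
      fun_prop
    · unfold Motion.upperAcc
      fun_prop
  · rcases hw.after with h1 | h1
    · left
      filter_upwards [hR, h1] with s h2 h3
      rw [← h2.self_of_nhds.1]
      exact h3.2
    · right
      filter_upwards [hR, h1] with s h2 h3 using h3.congr h2
  · rcases hl h0 with h1 | h1
    · left
      filter_upwards [hL', h1] with s h2 h3
      rwa [← h2.1]
    · right
      filter_upwards [hL, h1] with s h2 h3 using h3.congr h2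

theorem Motion.StartsAt.eventually_solvesAt {γ μ T x₀ u₀ y₀ v₀ : ℝ} {w : Motion}
    (hw : w.StartsAt γ μ T x₀ u₀ y₀ v₀) : ∀ᶠ t in 𝓝[>] T, w.SolvesAt γ μ t := by
  rcases hw.after with h | h
  · exact h.mono fun t ht => .of_flight ht.1 ht.2
  · obtain ⟨b, hb, hsub⟩ := mem_nhdsGT_iff_exists_Ioo_subset.1 h
    filter_upwards [Ioo_mem_nhdsGT hb] with t ht
    refine .of_stuck ?_
    filter_upwards [isOpen_Ioo.mem_nhds ht] with s hs using hsub hs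

theorem Motion.isSolution_glue {γ μ T x₀ u₀ y₀ v₀ : ℝ} {m w : Motion} (hT : 0 ≤ T)
    (hm : m.IsSolution γ μ T) (hw : w.StartsAt γ μ T x₀ u₀ y₀ v₀)
    (hg : (Motion.glue T m w).SolvesAt γ μ T) :
    ∃ T' : ℝ, T < T' ∧ (Motion.glue T m w).IsSolution γ μ T' := by
  obtain ⟨T', hTT', hsub⟩ := mem_nhdsGT_iff_exists_Ioo_subset.1 hw.eventually_solvesAt
  refine ⟨T', hTT', Motion.isSolution_iff.2 fun t ht => ?_⟩
  obtain ⟨h0, h1⟩ := mem_timeDomain_coe.1 ht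
  rcases lt_trichotomy t T with h | rfl | h
  · exact (Motion.isSolution_iff.1 hm t (IsSolution.mem_of_Ico h0 h)).congr
      ((gt_mem_nhds h).mono fun s hs => Motion.agree_glue_left m w hs)
  · exact hg
  · exact Motion.SolvesAt.congr (hsub ⟨h, h1⟩)
      ((lt_mem_nhds h).mono fun s hs => Motion.agree_glue_right m w (le_of_lt hs))

theorem exists_local_solution {γ μ x₀ u₀ y₀ v₀ : ℝ} (hγ : 0 < γ) (hx₀ : 0 ≤ x₀)
    (hu₀ : x₀ = 0 → 0 ≤ u₀) :
    ∃ T : ℝ, 0 < T ∧ ∃ m : Motion, m.IsSolution γ μ T ∧ m.StartsFrom x₀ u₀ y₀ v₀ := by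
  obtain ⟨w, hw⟩ := exists_startsAt (μ := μ) (T := 0) (y₀ := y₀) (v₀ := v₀) hγ hx₀ hu₀
  have hm : w.IsSolution γ μ ((0 : ℝ) : EReal) := Motion.isSolution_iff.2 fun t ht => by
    have := mem_timeDomain_coe.1 ht
    linarith
  -- Gluing at time `0` onto the vacuous solution on `[0, 0)`: all conditions from the left are
  -- empty.
  obtain ⟨T, hT, hg⟩ := Motion.isSolution_glue le_rfl hm hw (Motion.solvesAt_glue le_rfl hm hw hx₀
    (fun h => absurd h (lt_irrefl _)) (fun h => absurd h (lt_irrefl _))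
    (fun h => absurd h (lt_irrefl _)) (fun h => absurd h (lt_irrefl _))
    (fun h => absurd h (lt_irrefl _)) (fun h => absurd h (lt_irrefl _)))
  obtain ⟨e1, e2, e3, e4⟩ := Motion.agree_glue_right w w (le_refl (0 : ℝ))
  exact ⟨T, hT, _, hg, e1 ▸ hw.x_eq, e2 ▸ hw.u_eq, e3 ▸ hw.y_eq, e4 ▸ hw.v_eq⟩

/-- This is where existence needs the absence of collapse: with no impacts just before `T`, the
velocity itself, not only the speed, is Lipschitz or zero. -/
theorem Motion.IsSolution.exists_u_limit {γ μ T : ℝ} {m : Motion} (hγ : 0 < γ) (hμ : 0 < μ)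
    (hT : 0 < T) (h : m.IsSolution γ μ T) : ∃ us, Tendsto m.u (𝓝[<] T) (𝓝 us) := by
  rcases h.flight_or_stuck_near_end hγ hμ hT with h1 | h1
  · obtain ⟨M, -, hM⟩ := h.exists_bound hγ hμ.le
    obtain ⟨s, hs0, hsT, hs⟩ := exists_Ioo_of_eventually_left hT h1
    refine exists_left_limit (s := (s + T) / 2) (K := γ + 1 / 2 + M + 2 * μ * M) (by linarith)
      fun a b ha hab hb => ?_
    have hD : ∀ t ∈ Icc a b, t ∈ timeDomain (T : EReal) ∧ m.FreeAt γ μ t := fun t ht => by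
      have htD : t ∈ timeDomain (T : EReal) :=
        mem_of_Ico (by linarith [ht.1]) (by linarith [ht.2])
      exact ⟨htD, h.flight t htD (by linarith [ht.1])
        (hs t (by linarith [ht.1]) (by linarith [ht.2]))⟩
    exact abs_sub_le_of_right_deriv hab
      (fun t ht => (hD t ht).2.deriv_u.continuousAt.continuousWithinAt) fun t ht =>
      have h2 := hD t (Ico_subset_Icc_self ht)
      ⟨_, h2.2.deriv_u.hasDerivWithinAt, abs_lowerAcc_le hγ hμ.le (hM t h2.1)⟩
  · exact ⟨0, tendsto_const_nhds.congr' (h1.mono fun t ht => ht.u_eq.symm)⟩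

theorem Motion.IsSolution.exists_extension {γ μ T : ℝ} {m : Motion} (hγ : 0 < γ) (hμ : 0 < μ)
    (hT : 0 < T) (h : m.IsSolution γ μ T) :
    ∃ T' : ℝ, T < T' ∧ ∃ m' : Motion, m'.IsSolution γ μ T' ∧ ∀ t < T, m.Agree m' t := by
  obtain ⟨xs, ys, vs, hx, hy, hv⟩ := h.exists_limits hγ hμ hT
  obtain ⟨us, hu⟩ := h.exists_u_limit hγ hμ hT
  have hl := h.flight_or_stuck_near_end hγ hμ hT
  have hxs : 0 ≤ xs := ge_of_tendsto hx (by
    filter_upwards [eventually_Ioo_left hT] with t ht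
    exact h.x_nonneg t (mem_of_Ico ht.1.le ht.2))
  -- The mass reaches the floor from above, so its reversed velocity `-us` is an admissible velocity
  -- after the impact.
  have hus : xs = 0 → us ≤ 0 := by
    rintro rfl
    by_contra! hpos
    have h1 := eventually_le_of_le_right_deriv (c := us / 2) hT
      (h.x_cont.mono fun t ht => mem_of_Ico ht.1 ht.2)
      (fun t ht => h.x_deriv (mem_of_Ico ht.1 ht.2)) hx
      ((hu.eventually (lt_mem_nhds (by linarith : us / 2 < us))).mono fun t ht => ht.le)
    obtain ⟨t, h2, h3⟩ := (h1.and (eventually_Ioo_left hT)).exists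
    have h4 := h.x_nonneg t (mem_of_Ico h3.1.le h3.2)
    have h5 : 0 < us / 2 * (T - t) := mul_pos (by linarith) (by linarith)
    linarith
  have key : ∃ u₀, (xs = 0 → 0 ≤ u₀) ∧ (0 < xs → us = u₀) ∧ (xs = 0 → us = -u₀) := by
    rcases hxs.eq_or_lt with h0 | h0
    · exact ⟨-us, fun h1 => by linarith [hus h1], fun h1 => by linarith, fun _ => by ring⟩
    · exact ⟨us, fun h1 => by linarith, fun _ => rfl, fun h1 => by linarith⟩
  obtain ⟨u₀, hu0, hu1, hu2⟩ := key
  obtain ⟨w, hw⟩ := exists_startsAt (μ := μ) (T := T) (y₀ := ys) (v₀ := vs) hγ hxs hu0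
  obtain ⟨T', hT', hg⟩ := Motion.isSolution_glue hT.le h hw (Motion.solvesAt_glue hT.le h hw hxs
    (fun _ => hx) (fun _ => hy) (fun _ => hv) (fun _ h1 => hu1 h1 ▸ hu) (fun _ h1 => hu2 h1 ▸ hu)
    (fun _ => hl))
  exact ⟨T', hT', _, hg, fun t ht => Motion.agree_glue_left m w ht⟩

/-! ### Global existence -/

theorem Motion.Agree.trans {m₁ m₂ m₃ : Motion} {t : ℝ} (h : m₁.Agree m₂ t) (h' : m₂.Agree m₃ t) :
    m₁.Agree m₃ t :=
  ⟨h.1.trans h'.1, h.2.1.trans h'.2.1, h.2.2.1.trans h'.2.2.1, h.2.2.2.trans h'.2.2.2⟩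

theorem Motion.Agree.symm {m₁ m₂ : Motion} {t : ℝ} (h : m₁.Agree m₂ t) : m₂.Agree m₁ t :=
  ⟨h.1.symm, h.2.1.symm, h.2.2.1.symm, h.2.2.2.symm⟩

theorem Motion.Agree.refl (m : Motion) (t : ℝ) : m.Agree m t := ⟨rfl, rfl, rfl, rfl⟩

/-- The second solution, a motion together with its time of existence, extends the first. -/
def Extends (p q : EReal × Motion) : Prop :=
  p.1 ≤ q.1 ∧ ∀ t : ℝ, (t : EReal) < p.1 → p.2.Agree q.2 t

theorem Extends.refl (p : EReal × Motion) : Extends p p := ⟨le_rfl, fun t _ => .refl _ t⟩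

theorem Extends.trans {p q r : EReal × Motion} (h : Extends p q) (h' : Extends q r) :
    Extends p r :=
  ⟨h.1.trans h'.1, fun t ht => (h.2 t ht).trans (h'.2 t (ht.trans_le h.1))⟩

open Classical in
/-- The union of a set of compatible solutions. -/
noncomputable def unionMotion (c : Set (EReal × Motion)) : Motion where
  x t := if h : ∃ p ∈ c, (t : EReal) < p.1 then h.choose.2.x t else 0
  u t := if h : ∃ p ∈ c, (t : EReal) < p.1 then h.choose.2.u t else 0
  y t := if h : ∃ p ∈ c, (t : EReal) < p.1 then h.choose.2.y t else 0
  v t := if h : ∃ p ∈ c, (t : EReal) < p.1 then h.choose.2.v t else 0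

theorem agree_unionMotion {c : Set (EReal × Motion)}
    (hc : ∀ p ∈ c, ∀ q ∈ c, Extends p q ∨ Extends q p) {p : EReal × Motion} (hp : p ∈ c) {t : ℝ}
    (ht : (t : EReal) < p.1) : p.2.Agree (unionMotion c) t := by
  have h : ∃ p ∈ c, (t : EReal) < p.1 := ⟨p, hp, ht⟩
  have h1 : h.choose.2.Agree (unionMotion c) t := by
    simp only [Motion.Agree, unionMotion, dif_pos h, and_self]
  refine Motion.Agree.trans ?_ h1
  rcases hc p hp _ h.choose_spec.1 with h2 | h2
  · exact h2.2 t ht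
  · exact (h2.2 t h.choose_spec.2).symm

theorem isSolution_unionMotion {γ μ : ℝ} {c : Set (EReal × Motion)}
    (hc : ∀ p ∈ c, ∀ q ∈ c, Extends p q ∨ Extends q p)
    (hsol : ∀ p ∈ c, p.2.IsSolution γ μ p.1) :
    (unionMotion c).IsSolution γ μ (sSup (Prod.fst '' c)) := by
  refine Motion.isSolution_iff.2 fun t ht => ?_
  obtain ⟨_, ⟨p, hp, rfl⟩, htp⟩ := lt_sSup_iff.1 ht.2
  have htD : t ∈ timeDomain p.1 := ⟨ht.1, htp⟩
  refine (Motion.isSolution_iff.1 (hsol p hp) t htD).congr ?_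
  filter_upwards [eventually_coe_lt htD] with s hs using agree_unionMotion hc hp hs

/-- Zorn's lemma for the preorder `Extends`: unions bound chains, since being a solution is local in
time. Antisymmetry fails because values beyond the lifetime are arbitrary, but it suffices that a
maximal lifetime cannot be finite. -/
theorem exists_global_solution {γ μ x₀ u₀ y₀ v₀ : ℝ} (hγ : 0 < γ) (hμ : 0 < μ) (hx₀ : 0 ≤ x₀)
    (hu₀ : x₀ = 0 → 0 ≤ u₀) :
    ∃ m : Motion, m.IsSolution γ μ ⊤ ∧ m.StartsFrom x₀ u₀ y₀ v₀ := by
  have hstart : ∀ {m m' : Motion}, m.StartsFrom x₀ u₀ y₀ v₀ → m.Agree m' 0 →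
      m'.StartsFrom x₀ u₀ y₀ v₀ := fun h e =>
    ⟨e.1 ▸ h.1, e.2.1 ▸ h.2.1, e.2.2.1 ▸ h.2.2.1, e.2.2.2 ▸ h.2.2.2⟩
  obtain ⟨T₀, hT₀, m₀, hm₀, hs₀⟩ :=
    exists_local_solution (μ := μ) (y₀ := y₀) (v₀ := v₀) hγ hx₀ hu₀
  let A := {p : EReal × Motion // 0 < p.1 ∧ p.2.IsSolution γ μ p.1 ∧ p.2.StartsFrom x₀ u₀ y₀ v₀}
  let p₀ : A := ⟨((T₀ : EReal), m₀), EReal.coe_pos.2 hT₀, hm₀, hs₀⟩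
  obtain ⟨⟨⟨T, m⟩, hT, hm, hs⟩, hmax⟩ := exists_maximal_of_chains_bounded
    (r := fun p q : A => Extends p.1 q.1) (fun c hc => by
      rcases c.eq_empty_or_nonempty with rfl | ⟨q, hq⟩
      · exact ⟨p₀, fun a ha => absurd ha (notMem_empty a)⟩
      · have hc' : ∀ p ∈ Subtype.val '' c, ∀ q ∈ Subtype.val '' c,
            Extends p q ∨ Extends q p := by
          rintro _ ⟨p, hp, rfl⟩ _ ⟨q, hq, rfl⟩
          by_cases hpq : p = q
          · exact hpq ▸ Or.inl (.refl _)
          · exact hc hp hq hpq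
        have hle : ∀ p ∈ c, p.1.1 ≤ sSup (Prod.fst '' (Subtype.val '' c)) := fun p hp =>
          le_sSup ⟨_, ⟨p, hp, rfl⟩, rfl⟩
        refine ⟨⟨(sSup (Prod.fst '' (Subtype.val '' c)), unionMotion (Subtype.val '' c)),
          q.2.1.trans_le (hle q hq), isSolution_unionMotion hc' ?_,
          hstart q.2.2.2 (agree_unionMotion hc' ⟨q, hq, rfl⟩ q.2.1)⟩, fun p hp =>
          ⟨hle p hp, fun t ht => agree_unionMotion hc' ⟨p, hp, rfl⟩ ht⟩⟩
        rintro _ ⟨p, -, rfl⟩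
        exact p.2.2.1)
    (fun h h' => Extends.trans h h')
  induction T with
  | bot => exact absurd hT not_lt_bot
  | top => exact ⟨m, hm, hs⟩
  | coe T =>
    have hT0 : 0 < T := EReal.coe_pos.1 hT
    obtain ⟨T', hTT', m', hm', he⟩ := Motion.IsSolution.exists_extension hγ hμ hT0 hm
    have hlt : (T : EReal) < T' := by exact_mod_cast hTT'
    have := (hmax ⟨((T' : EReal), m'), hT.trans hlt, hm', hstart hs (he 0 hT0)⟩
      ⟨hlt.le, fun t ht => he t (EReal.coe_lt_coe_iff.1 ht)⟩).1
    exact absurd this (not_le.2 hlt)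

end BouncingBall

theorem theorem5 (γ μ : ℝ) (hγ : 0 < γ) (hμ : 0 < μ)
    (x₀ u₀ y₀ v₀ : ℝ) (hx₀ : 0 ≤ x₀) (hu₀ : x₀ = 0 → 0 ≤ u₀) :
    (∃ m : BouncingBall.Motion, m.IsSolution γ μ ⊤ ∧ m.StartsFrom x₀ u₀ y₀ v₀) ∧
    ∀ (T : EReal) (m : BouncingBall.Motion), 0 < T →
      m.IsSolution γ μ T → m.StartsFrom x₀ u₀ y₀ v₀ → (m.grazings T).Finite := by
  refine ⟨BouncingBall.exists_global_solution hγ hμ hx₀ hu₀, fun T m hT hm _ => ?_⟩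
  induction T with
  | bot => exact absurd hT not_lt_bot
  | top => exact hm.grazings_finite_of_top hγ hμ
  | coe T => exact hm.grazings_finite_of_coe hγ hμ (by exact_mod_cast hT)
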